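/- Let $q=2^s$ with $s\ge 4$ even, and let $n=q+1$. Let $m=\mathrm{ord}_n(q)$ (so $m=2$), let $\alpha$ be a generator of $\mathrm{GF}(q^m)^*$, and let $\beta=\alpha^{(q^m-1)/n}$, a primitive $n$-th root of unity. Let $\mathsf{C}=\mathsf{C}_{(q,q+1,3,1)}$ be the narrow-sense BCH code of length $q+1$ and designed distance $3$ over $\mathrm{GF}(q)$, that is, the cyclic code of length $q+1$ generated by $\mathrm{lcm}(\mathbb{M}_{\beta}(x),\mathbb{M}_{\beta^2}(x))$, where $\mathbb{M}_{\beta^i}(x)$ is the minimal polynomial of $\beta^i$ over $\mathrm{GF}(q)$. Let $\mathsf{C}^\perp$ be its dual with respect to the standard bilinear form on $\mathrm{GF}(q)^{q+1}$. Then: 1. $\mathsf{C}$ has parameters $[q+1,q-3,4]$ and $\mathsf{C}^\perp$ has parameters $[q+1,4,q-3]$. In particular, $\mathsf{C}$ is a near MDS code: $\mathsf{C}$ and $\mathsf{C}^\perp$ both have parameters of the form $[n,k,n-k]$. 2. The weight enumerator $\sum_{i=0}^{q+1}A_i^\perp z^i$ of $\mathsf{C}^\perp$, where $A_i^\perp$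 is the number of codewords of Hamming weight $i$ in $\mathsf{C}^\perp$, is $$1+\frac{(q-4)(q-1)q(q+1)}{24}z^{q-3}+\frac{(q-1)q(q+1)}{2}z^{q-2}+\frac{(q+1)q^2(q-1)}{4}z^{q-1}+\frac{(q-1)(q+1)(2q^2+q+6)}{6}z^{q}+\frac{3q^4-4q^3-3q^2+4q}{8}z^{q+1}.$$ 3. The supports of the codewords of weight $4$ in $\mathsf{C}$ are the blocks of a simple $2$-$\left(q+1,4,\frac{q-4}{2}\right)$ design on the set of $q+1$ coordinates. 4. The supports of the codewords of weight $q-3$ in $\mathsf{C}^\perp$ are the blocks of a simple $2$-$\left(q+1,q-3,\frac{(q-4)^2(q-3)}{24}\right)$ design. It is the complementary design of the one in part 3: its blocks are exactly the complements of the blocks of that design. Here a simple $t$-$(v,k,\lambda)$ design, with $v>k>t\ge 1$ and $\lambda\ge 1$, is a set of $k$-subsets (blocks) of a $v$-set such that every $t$-subset is contained in exactly $\lambda$ blocks. -/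

import Mathlib

open Polynomial

section BCHCodes

variable {F : Type*} [Field F]

/-- The cyclic code of length `n` over `F` generated by `g`: the words `(c₀, …, cₙ₋₁)` whose
polynomial `c₀ + c₁ x + ⋯ + cₙ₋₁ xⁿ⁻¹` lies, modulo `xⁿ - 1`, in the ideal of `F[x]/(xⁿ - 1)`
generated by `g`. -/
def cyclicCode (n : ℕ) (g : F[X]) : Submodule F (Fin n → F) where
  carrier := {c | AdjoinRoot.mk (X ^ n - 1 : F[X]) (∑ i : Fin n, C (c i) * X ^ (i : ℕ)) ∈
    Ideal.span {AdjoinRoot.mk (X ^ n - 1 : F[X]) g}}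
  zero_mem' := by simp
  add_mem' := by
    intro a b ha hb
    rw [Set.mem_ofPred_eq] at ha hb
    have h := Ideal.add_mem _ ha hb
    rw [← map_add, ← Finset.sum_add_distrib] at h
    simpa only [Set.mem_ofPred_eq, Pi.add_apply, C_add, add_mul] using h
  smul_mem' := by
    intro r a ha
    rw [Set.mem_ofPred_eq] at ha
    have h := Ideal.mul_mem_left _ (AdjoinRoot.mk (X ^ n - 1 : F[X]) (C r)) ha
    rw [← map_mul, Finset.mul_sum] at h
    simpa only [Set.mem_ofPred_eq, Pi.smul_apply, smul_eq_mul, C_mul, mul_assoc] using h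

/-- For a generator `α` of `GF(q^m)ˣ`, with `q = |F|` and `m = ord_n(q)`, the primitive `n`-th root
of unity `β = α ^ ((q ^ m - 1) / n)`. -/
noncomputable def bchRoot (F : Type*) {K : Type*} [Field K] (n : ℕ) (α : Kˣ) : Kˣ :=
  α ^ ((Nat.card F ^ orderOf (Nat.card F : ZMod n) - 1) / n)

/-- The generator polynomial of the BCH code of length `n` and designed distance `δ`: the monic
least common multiple over `F` of the minimal polynomials of `β ^ h, …, β ^ (h + δ - 2)`. -/
noncomputable def bchGenerator (F : Type*) [Field F] {K : Type*} [Field K] [Algebra F K]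
    (n δ : ℕ) (h : ℤ) (α : Kˣ) : F[X] :=
  letI := Classical.decEq F
  letI := UniqueFactorizationMonoid.toNormalizedGCDMonoid F[X]
  (Finset.range (δ - 1)).lcm fun i => minpoly F ((bchRoot F n α ^ (h + (i : ℤ)) : Kˣ) : K)

/-- The BCH code `C_(q,n,δ,h)` over `F = GF(q)`, formed with the generator `α` of `GF(q^m)ˣ`. -/
noncomputable def bchCode (F : Type*) [Field F] {K : Type*} [Field K] [Algebra F K]
    (n δ : ℕ) (h : ℤ) (α : Kˣ) : Submodule F (Fin n → F) :=
  cyclicCode n (bchGenerator F n δ h α)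

end BCHCodes

section LinearCodes

variable {F : Type*} [Field F] {n : ℕ}

/-- The dual code, for the standard bilinear form on `Fⁿ`. -/
def dualCode (C : Submodule F (Fin n → F)) : Submodule F (Fin n → F) where
  carrier := {y | ∀ x ∈ C, x ⬝ᵥ y = 0}
  zero_mem' := by intro x _; simp
  add_mem' := by
    intro a b ha hb x hx
    rw [dotProduct_add, ha x hx, hb x hx, add_zero]
  smul_mem' := by
    intro r a ha x hx
    rw [dotProduct_smul, ha x hx, smul_zero]

variable [DecidableEq F]

/-- `d` is the minimum Hamming distance between distinct codewords of `C`. -/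
def IsMinDistance (C : Submodule F (Fin n → F)) (d : ℕ) : Prop :=
  IsLeast {e | ∃ x ∈ C, ∃ y ∈ C, x ≠ y ∧ hammingDist x y = e} d

/-- `C`, a code of length `n`, has parameters `[n, k, d]`. -/
def HasParameters (C : Submodule F (Fin n → F)) (k d : ℕ) : Prop :=
  Module.finrank F C = k ∧ IsMinDistance C d

/-- Almost MDS: parameters `[n, k, n - k]`, that is, Singleton defect `n - k + 1 - d = 1`. -/
def IsAMDS (C : Submodule F (Fin n → F)) : Prop :=
  ∃ k d : ℕ, HasParameters C k d ∧ k + d = n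

/-- Near MDS: the code and its dual are both almost MDS. -/
def IsNMDS (C : Submodule F (Fin n → F)) : Prop :=
  IsAMDS C ∧ IsAMDS (dualCode C)

/-- `A_i`, the number of codewords of Hamming weight `i`. -/
noncomputable def weightDistribution (C : Submodule F (Fin n → F)) (i : ℕ) : ℕ :=
  {c : Fin n → F | c ∈ C ∧ hammingNorm c = i}.ncard

/-- The weight enumerator `∑ A_i z^i`, with rational coefficients. -/
noncomputable def weightEnumerator (C : Submodule F (Fin n → F)) : ℚ[X] :=
  ∑ i ∈ Finset.range (n + 1), Polynomial.C (weightDistribution C i : ℚ) * X ^ i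

/-- The support of a word. -/
def wordSupport (c : Fin n → F) : Finset (Fin n) :=
  Finset.univ.filter fun i => c i ≠ 0

/-- The set of supports of the codewords of Hamming weight `w`. -/
def supportBlocks (C : Submodule F (Fin n → F)) (w : ℕ) : Set (Finset (Fin n)) :=
  {b | ∃ c ∈ C, hammingNorm c = w ∧ wordSupport c = b}

end LinearCodes

/-- The blocks `B` form a (simple) `t`-`(v, k, lam)` design on the points `P`, under the standing
convention `v > k > t ≥ 1` and with `lam ≥ 1`. -/
def IsDesign {P : Type*} [Fintype P] (B : Set (Finset P)) (t v k lam : ℕ) : Prop :=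
  Fintype.card P = v ∧ 1 ≤ t ∧ t < k ∧ k < v ∧ 1 ≤ lam ∧ (∀ b ∈ B, b.card = k) ∧
    ∀ T : Finset P, T.card = t → {b ∈ B | T ⊆ b}.ncard = lam

/-! Put U for the norm-one elements of K, that is, the (q+1)-st roots of unity, where Frobenius acts
as inversion. The code is cut out by Σ cᵢuᵢ = 0 and Σ cᵢuᵢ² = 0, with uᵢ running through U.
Conjugating these checks gives the ones with uᵢ⁻¹ and uᵢ⁻², so every polynomial of degree at most 4
without x² term, divided by x², is a check over K (`IsUnitCircle.sum_mul_eq_zero`).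

Since s is even, 3 does not divide q+1, so cubing is injective on U. Hence the first two elementary
symmetric functions e₁, e₂ of three distinct points do not vanish. A cubic without x² term then
isolates any coordinate of a word of weight at most 3, so the minimum distance is at least 4. Four
distinct points support a word of weight 4 exactly when their e₂ vanishes
(`IsUnitCircle.mem_supportBlocks_iff`): then the quartic with these roots has no x² term and,
suitably scaled, takes values in F after division by x², so it is a dual word.

Given three points, e₂ = 0 is linear in the fourth, with solution e₂/e₁ in U. So two blocks sharing
three points agree, and a pair lies in (q-4)/2 blocks, as exactly five choices of the third point
are bad (`IsUnitCircle.card_good`).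

The rest is formal. For a code of codimension 4 without nonzero words of weight at most 3,
shortening/puncturing duality shows that a 4-set is a block iff some nonzero dual word vanishes on
it. Block uniqueness forbids five zeros, so minimum-weight dual supports are the complements of
blocks. Counting dual words that vanish on j-sets, j ≤ 4, gives a triangular system for the weight
distribution. -/

/-! ### Duality between shortening and puncturing. -/

section LinearAlgebra

variable {F : Type*} [Field F] {n : ℕ}

/-- The words whose support is contained in `T`. -/
def supportedWords (F : Type*) [Field F] {n : ℕ} (T : Finset (Fin n)) :
    Submodule F (Fin n → F) where
  carrier := {c | ∀ i ∉ T, c i = 0}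
  zero_mem' := by intro i _; rfl
  add_mem' := by
    intro a b ha hb i hi
    simp [ha i hi, hb i hi]
  smul_mem' := by
    intro r a ha i hi
    simp [ha i hi]

theorem mem_supportedWords {T : Finset (Fin n)} {c : Fin n → F} :
    c ∈ supportedWords F T ↔ ∀ i ∉ T, c i = 0 := Iff.rfl

theorem mem_dualCode {C : Submodule F (Fin n → F)} {y : Fin n → F} :
    y ∈ dualCode C ↔ ∀ x ∈ C, x ⬝ᵥ y = 0 := Iff.rfl

theorem finrank_supportedWords (T : Finset (Fin n)) :
    Module.finrank F (supportedWords F T) = T.card := by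
  let e : supportedWords F T ≃ₗ[F] (T → F) :=
    { toFun := fun c i => c.1 i
      map_add' := fun _ _ => rfl
      map_smul' := fun _ _ => rfl
      invFun := fun f => ⟨fun i => if h : i ∈ T then f ⟨i, h⟩ else 0, fun i hi => by simp [hi]⟩
      left_inv := by
        intro c
        ext i
        by_cases hi : i ∈ T
        · simp [hi]
        · simp [hi, c.2 i hi]
      right_inv := by
        intro f
        ext i
        simp }
  rw [e.finrank_eq, Module.finrank_fintype_fun_eq_card, Fintype.card_coe]

theorem nondegenerate_dotProductBilin :
    (dotProductBilin F F : LinearMap.BilinForm F (Fin n → F)).Nondegenerate := by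
  constructor
  · intro x hx
    exact dotProduct_eq_zero x fun y => by simpa using hx y
  · intro x hx
    exact dotProduct_eq_zero x fun y => by rw [dotProduct_comm]; simpa using hx y

theorem dualCode_eq_orthogonal (C : Submodule F (Fin n → F)) :
    dualCode C = LinearMap.BilinForm.orthogonal (dotProductBilin F F) C := by
  ext y
  simp [mem_dualCode, LinearMap.BilinForm.mem_orthogonal_iff]

theorem finrank_dualCode (C : Submodule F (Fin n → F)) :
    Module.finrank F (dualCode C) + Module.finrank F C = n := by
  have h := LinearMap.BilinForm.finrank_orthogonal (B := dotProductBilin F F)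
    nondegenerate_dotProductBilin C
  have h2 := Submodule.finrank_le C
  rw [Module.finrank_fin_fun] at h h2
  rw [dualCode_eq_orthogonal, h]
  omega

/-- Orthogonality to the unit vectors indexed by `T` is vanishing on `T`. -/
theorem dualCode_sup_supportedWords (C : Submodule F (Fin n → F)) (T : Finset (Fin n)) :
    dualCode (C ⊔ supportedWords F T) = dualCode C ⊓ supportedWords F Tᶜ := by
  ext y
  simp only [Submodule.mem_inf, mem_dualCode, mem_supportedWords, Finset.mem_compl, not_not]
  constructor
  · intro h
    refine ⟨fun x hx => h x (Submodule.mem_sup_left hx), fun i hi => ?_⟩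
    have := h (Pi.single i 1) (Submodule.mem_sup_right fun j hj => ?_)
    · simpa using this
    · rw [Pi.single_eq_of_ne]
      rintro rfl
      exact hj hi
  · rintro ⟨h1, h2⟩ x hx
    obtain ⟨a, ha, b, hb, rfl⟩ := Submodule.mem_sup.1 hx
    rw [add_dotProduct, h1 a ha, zero_add]
    refine Finset.sum_eq_zero fun i _ => ?_
    by_cases hi : i ∈ T
    · simp [h2 i hi]
    · simp [hb i hi]

/-- Shortening a code and puncturing its dual: the dimensions of the subcode supported in `T` and of
the subcode of the dual that vanishes on `T` determine each other. -/
theorem finrank_dualCode_inf (C : Submodule F (Fin n → F)) (T : Finset (Fin n)) :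
    Module.finrank F (dualCode C ⊓ supportedWords F Tᶜ : Submodule F (Fin n → F)) +
      Module.finrank F C + T.card =
    n + Module.finrank F (C ⊓ supportedWords F T : Submodule F (Fin n → F)) := by
  have h1 := finrank_dualCode (C ⊔ supportedWords F T)
  have h2 := Submodule.finrank_sup_add_finrank_inf_eq C (supportedWords F T)
  rw [dualCode_sup_supportedWords] at h1
  rw [finrank_supportedWords] at h2
  omega

theorem finrank_dualCode_inf_of_codim_four {C : Submodule F (Fin n → F)}
    (hdim : Module.finrank F C + 4 = n)
    (T : Finset (Fin n)) :
    Module.finrank F (dualCode C ⊓ supportedWords F Tᶜ : Submodule F (Fin n → F)) + T.card =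
      4 + Module.finrank F (C ⊓ supportedWords F T : Submodule F (Fin n → F)) := by
  have := finrank_dualCode_inf C T
  omega

end LinearAlgebra

/-! ### Words of a code on a set of at most d+1 coordinates. -/

section NearMDS

variable {F : Type*} [Field F] [DecidableEq F] {n : ℕ} {C : Submodule F (Fin n → F)}

theorem card_wordSupport (c : Fin n → F) : (wordSupport c).card = hammingNorm c := rfl

theorem mem_wordSupport {c : Fin n → F} {i : Fin n} : i ∈ wordSupport c ↔ c i ≠ 0 := by
  simp [wordSupport]

theorem mem_supportedWords_iff_wordSupport_subset {T : Finset (Fin n)} {c : Fin n → F} :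
    c ∈ supportedWords F T ↔ wordSupport c ⊆ T := by
  rw [mem_supportedWords]
  constructor
  · intro h i hi
    by_contra hiT
    exact mem_wordSupport.1 hi (h i hiT)
  · intro h i hi
    by_contra hc
    exact hi (h (mem_wordSupport.2 hc))

theorem mem_supportedWords_compl {T : Finset (Fin n)} {c : Fin n → F} :
    c ∈ supportedWords F Tᶜ ↔ T ⊆ (wordSupport c)ᶜ := by
  rw [mem_supportedWords_iff_wordSupport_subset, Finset.subset_compl_comm]

theorem inf_supportedWords_eq_bot {d : ℕ} (hmin : ∀ c ∈ C, hammingNorm c ≤ d → c = 0)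
    {T : Finset (Fin n)} (hT : T.card ≤ d) : C ⊓ supportedWords F T = ⊥ := by
  rw [Submodule.eq_bot_iff]
  rintro c ⟨hc, hcT⟩
  exact hmin c hc ((Finset.card_le_card (mem_supportedWords_iff_wordSupport_subset.1 hcT)).trans hT)

theorem inf_supportedWords_eq_bot_of_notMem {d : ℕ}
    (hmin : ∀ c ∈ C, hammingNorm c ≤ d → c = 0) {T : Finset (Fin n)} (hT : T.card = d + 1)
    (hTB : T ∉ supportBlocks C (d + 1)) : C ⊓ supportedWords F T = ⊥ := by
  rw [Submodule.eq_bot_iff]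
  rintro c ⟨hc, hcT⟩
  have hsub := mem_supportedWords_iff_wordSupport_subset.1 hcT
  refine hmin c hc ?_
  by_contra! hlt
  have heq : wordSupport c = T := Finset.eq_of_subset_of_card_le hsub (by
    rw [card_wordSupport]; omega)
  exact hTB ⟨c, hc, by rw [← card_wordSupport, heq, hT], heq⟩

/-- Subtracting the multiple of the block's word that cancels one coordinate leaves a word on at
most `d` positions, hence zero. -/
theorem finrank_inf_supportedWords_of_mem {d : ℕ} (hmin : ∀ c ∈ C, hammingNorm c ≤ d → c = 0)
    {T : Finset (Fin n)} (hTB : T ∈ supportBlocks C (d + 1)) :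
    Module.finrank F (C ⊓ supportedWords F T : Submodule F (Fin n → F)) = 1 := by
  obtain ⟨c, hc, hcd, rfl⟩ := hTB
  have hcard : (wordSupport c).card = d + 1 := hcd
  obtain ⟨i, hi⟩ : (wordSupport c).Nonempty := Finset.card_pos.1 (by omega)
  have hci := mem_wordSupport.1 hi
  refine finrank_eq_one
    (⟨c, hc, mem_supportedWords_iff_wordSupport_subset.2 subset_rfl⟩ :
      (C ⊓ supportedWords F (wordSupport c) : Submodule F (Fin n → F))) ?_ ?_
  · intro h
    exact hci (congrFun (congrArg Subtype.val h) i)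
  · rintro ⟨w, hw, hwT⟩
    refine ⟨w i / c i, Subtype.ext ?_⟩
    have hz : w - (w i / c i) • c ∈
        C ⊓ supportedWords F ((wordSupport c).erase i) := by
      refine ⟨C.sub_mem hw (C.smul_mem _ hc), fun j hj => ?_⟩
      by_cases hji : j = i
      · subst hji
        simp [hci]
      · have hj' : j ∉ wordSupport c := fun h => hj (Finset.mem_erase.2 ⟨hji, h⟩)
        have h0 : c j = 0 := by simpa [mem_wordSupport] using hj'
        simp [h0, hwT j hj']
    rw [inf_supportedWords_eq_bot hmin (by rw [Finset.card_erase_of_mem hi]; omega),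
      Submodule.mem_bot, sub_eq_zero] at hz
    exact hz.symm

end NearMDS

/-! ### Dual of a codimension-4 code: zeros, supports, parameters. -/

section NearMDSDual

variable {F : Type*} [Field F] [DecidableEq F] {n : ℕ} {C : Submodule F (Fin n → F)}

theorem isMinDistance_of_hammingNorm {d : ℕ} (hd : d ≠ 0) (h1 : ∃ c ∈ C, hammingNorm c = d)
    (h2 : ∀ c ∈ C, c ≠ 0 → d ≤ hammingNorm c) : IsMinDistance C d := by
  constructor
  · obtain ⟨c, hc, hcd⟩ := h1
    refine ⟨c, hc, 0, C.zero_mem, ?_, ?_⟩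
    · rintro rfl
      exact hd (by simpa using hcd.symm)
    · rw [hammingDist_zero_right, hcd]
  · rintro e ⟨x, hx, y, hy, hxy, rfl⟩
    rw [hammingDist_eq_hammingNorm]
    exact h2 _ (C.add_mem (C.neg_mem hx) hy) fun h => hxy (neg_add_eq_zero.1 h)

/-- For a 4-set carrying no nonzero word of `C`, the dimension formula leaves dimension 0 for the
dual words vanishing on it. -/
theorem eq_zero_of_notMem_supportBlocks (hdim : Module.finrank F C + 4 = n)
    (hmin : ∀ c ∈ C, hammingNorm c ≤ 3 → c = 0) {T : Finset (Fin n)} (hT : T.card = 4)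
    (hTB : T ∉ supportBlocks C 4) {y : Fin n → F} (hy : y ∈ dualCode C)
    (hTy : T ⊆ (wordSupport y)ᶜ) : y = 0 := by
  have h := finrank_dualCode_inf_of_codim_four hdim T
  rw [inf_supportedWords_eq_bot_of_notMem hmin hT hTB, finrank_bot, hT] at h
  have h0 : dualCode C ⊓ supportedWords F Tᶜ = ⊥ := Submodule.finrank_eq_zero.1 (by omega)
  have : y ∈ dualCode C ⊓ supportedWords F Tᶜ := ⟨hy, mem_supportedWords_compl.2 hTy⟩
  rwa [h0, Submodule.mem_bot] at this

/-- With five zeros, each 4-subset of them would be a block, and two of these share three points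
without being equal. -/
theorem card_zeros_le_four (hdim : Module.finrank F C + 4 = n)
    (hmin : ∀ c ∈ C, hammingNorm c ≤ 3 → c = 0)
    (hB : ∀ b ∈ supportBlocks C 4, ∀ b' ∈ supportBlocks C 4, 2 < (b ∩ b').card → b = b')
    {y : Fin n → F} (hy : y ∈ dualCode C) (hy0 : y ≠ 0) : (wordSupport y)ᶜ.card ≤ 4 := by
  by_contra! hlt
  obtain ⟨T, hTy, hT⟩ := Finset.exists_subset_card_eq (show 5 ≤ (wordSupport y)ᶜ.card from hlt)
  obtain ⟨i, hi, j, hj, hij⟩ := Finset.one_lt_card.1 (show 1 < T.card by omega)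
  have key : ∀ k ∈ T, T.erase k ∈ supportBlocks C 4 := by
    intro k hk
    by_contra hc
    exact hy0 (eq_zero_of_notMem_supportBlocks hdim hmin
      (by rw [Finset.card_erase_of_mem hk, hT]) hc hy ((Finset.erase_subset _ _).trans hTy))
  have hcard : 2 < (T.erase i ∩ T.erase j).card := by
    have : T.erase i ∩ T.erase j = (T.erase i).erase j := by
      ext k
      simp only [Finset.mem_inter, Finset.mem_erase]
      tauto
    rw [this, Finset.card_erase_of_mem (Finset.mem_erase.2 ⟨hij.symm, hj⟩),
      Finset.card_erase_of_mem hi, hT]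
    omega
  have h := hB _ (key i hi) _ (key j hj) hcard
  have : j ∈ T.erase i := Finset.mem_erase.2 ⟨hij.symm, hj⟩
  rw [h] at this
  simp at this

/-- On a block the dimension formula reads 4 + 1 - 4 = 1. -/
theorem exists_dualCode_of_mem_supportBlocks (hdim : Module.finrank F C + 4 = n)
    (hmin : ∀ c ∈ C, hammingNorm c ≤ 3 → c = 0)
    {T : Finset (Fin n)} (hT : T ∈ supportBlocks C 4) :
    ∃ y ∈ dualCode C, y ≠ 0 ∧ T ⊆ (wordSupport y)ᶜ := by
  have h := finrank_dualCode_inf_of_codim_four hdim T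
  rw [finrank_inf_supportedWords_of_mem hmin hT] at h
  have hcard : T.card = 4 := by
    obtain ⟨c, -, hc, rfl⟩ := hT
    exact hc
  have hne : dualCode C ⊓ supportedWords F Tᶜ ≠ ⊥ := by
    intro h0
    rw [h0, finrank_bot] at h
    omega
  obtain ⟨y, ⟨hy, hyT⟩, hy0⟩ := Submodule.exists_mem_ne_zero_of_ne_bot hne
  exact ⟨y, hy, hy0, mem_supportedWords_compl.1 hyT⟩

theorem card_zeros_add_hammingNorm (y : Fin n → F) :
    (wordSupport y)ᶜ.card + hammingNorm y = n := by
  rw [← card_wordSupport, add_comm, Finset.card_add_card_compl, Fintype.card_fin]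

theorem card_of_mem_supportBlocks {w : ℕ} {b : Finset (Fin n)} (hb : b ∈ supportBlocks C w) :
    b.card = w := by
  obtain ⟨c, -, hc, rfl⟩ := hb
  exact hc

theorem supportBlocks_dualCode (hn : 4 < n) (hdim : Module.finrank F C + 4 = n)
    (hmin : ∀ c ∈ C, hammingNorm c ≤ 3 → c = 0)
    (hB : ∀ b ∈ supportBlocks C 4, ∀ b' ∈ supportBlocks C 4, 2 < (b ∩ b').card → b = b') :
    supportBlocks (dualCode C) (n - 4) = (fun b => bᶜ) '' supportBlocks C 4 := by
  ext S
  constructor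
  · rintro ⟨y, hy, hyn, rfl⟩
    have hz := card_zeros_add_hammingNorm y
    have hy0 : y ≠ 0 := by
      rintro rfl
      rw [hammingNorm_zero] at hyn
      omega
    refine ⟨(wordSupport y)ᶜ, ?_, compl_compl _⟩
    by_contra hc
    exact hy0 (eq_zero_of_notMem_supportBlocks hdim hmin (by omega) hc hy subset_rfl)
  · rintro ⟨T, hT, rfl⟩
    obtain ⟨y, hy, hy0, hTy⟩ := exists_dualCode_of_mem_supportBlocks hdim hmin hT
    have hle := card_zeros_le_four hdim hmin hB hy hy0
    have heq : T = (wordSupport y)ᶜ :=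
      Finset.eq_of_subset_of_card_le hTy (by rwa [card_of_mem_supportBlocks hT])
    have hz := card_zeros_add_hammingNorm y
    rw [← heq, card_of_mem_supportBlocks hT] at hz
    exact ⟨y, hy, by omega, by simp [heq]⟩

theorem hasParameters_dualCode (hn : 4 < n) (hdim : Module.finrank F C + 4 = n)
    (hmin : ∀ c ∈ C, hammingNorm c ≤ 3 → c = 0)
    (hB : ∀ b ∈ supportBlocks C 4, ∀ b' ∈ supportBlocks C 4, 2 < (b ∩ b').card → b = b')
    (hne : (supportBlocks C 4).Nonempty) : HasParameters (dualCode C) 4 (n - 4) := by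
  refine ⟨?_, isMinDistance_of_hammingNorm (by omega) ?_ ?_⟩
  · have := finrank_dualCode C
    omega
  · obtain ⟨T, hT⟩ := hne
    have : Tᶜ ∈ supportBlocks (dualCode C) (n - 4) := by
      rw [supportBlocks_dualCode hn hdim hmin hB]
      exact ⟨T, hT, rfl⟩
    obtain ⟨y, hy, hyn, -⟩ := this
    exact ⟨y, hy, hyn⟩
  · intro y hy hy0
    have h1 := card_zeros_le_four hdim hmin hB hy hy0
    have h2 := card_zeros_add_hammingNorm y
    omega

theorem hasParameters_of_supportBlocks_nonempty (hdim : Module.finrank F C + 4 = n)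
    (hmin : ∀ c ∈ C, hammingNorm c ≤ 3 → c = 0)
    (hne : (supportBlocks C 4).Nonempty) : HasParameters C (n - 4) 4 := by
  refine ⟨by omega, isMinDistance_of_hammingNorm (by omega) ?_ ?_⟩
  · obtain ⟨T, c, hc, hcn, -⟩ := hne
    exact ⟨c, hc, hcn⟩
  · intro c hc hc0
    by_contra! hlt
    exact hc0 (hmin c hc (by omega))

end NearMDSDual

/-! ### Counting words by their zero coordinates. -/

section WeightDistribution

open Classical in
/-- The nonzero words of `C` with exactly `k` zero coordinates. -/
noncomputable def wordsWithZeros {F : Type*} [Field F] [Fintype F] [DecidableEq F] {n : ℕ}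
    (C : Submodule F (Fin n → F)) (k : ℕ) : Finset (Fin n → F) :=
  Finset.univ.filter fun y => y ∈ C ∧ y ≠ 0 ∧ (wordSupport y)ᶜ.card = k

open Classical in
/-- The nonzero words of `C` that vanish on `T`. -/
noncomputable def wordsVanishingOn {F : Type*} [Field F] [Fintype F] [DecidableEq F] {n : ℕ}
    (C : Submodule F (Fin n → F)) (T : Finset (Fin n)) : Finset (Fin n → F) :=
  Finset.univ.filter fun y => y ∈ C ∧ y ≠ 0 ∧ T ⊆ (wordSupport y)ᶜ

variable {F : Type*} [Field F] [Fintype F] [DecidableEq F] {n : ℕ} {C : Submodule F (Fin n → F)}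

theorem card_wordsVanishingOn (T : Finset (Fin n)) :
    (wordsVanishingOn C T).card + 1 = Fintype.card F ^
      Module.finrank F (C ⊓ supportedWords F Tᶜ : Submodule F (Fin n → F)) := by
  classical
  rw [← Nat.card_eq_fintype_card, ← Module.natCard_eq_pow_finrank, Nat.card_eq_fintype_card,
    Fintype.card_subtype,
    ← Finset.card_erase_add_one (a := (0 : Fin n → F)) (Finset.mem_filter.2 ⟨Finset.mem_univ _,
      Submodule.zero_mem _⟩)]
  congr 2
  ext y
  simp only [wordsVanishingOn, Finset.mem_filter, Finset.mem_univ, true_and, Finset.mem_erase,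
    Submodule.mem_inf, mem_supportedWords_compl]
  tauto

theorem weightDistribution_eq_card_wordsWithZeros {k : ℕ} (hk : k < n) :
    weightDistribution C (n - k) = (wordsWithZeros C k).card := by
  classical
  rw [weightDistribution, ← Set.ncard_coe_finset]
  congr 1
  ext y
  have h := card_zeros_add_hammingNorm y
  simp only [wordsWithZeros, Set.mem_ofPred_eq, Finset.coe_filter, Finset.mem_univ, true_and]
  constructor
  · rintro ⟨h1, h2⟩
    refine ⟨h1, ?_, by omega⟩
    rintro rfl
    rw [hammingNorm_zero] at h2
    omega
  · rintro ⟨h1, -, h2⟩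
    exact ⟨h1, by omega⟩

/-- Double count of pairs (y, T), with T a `j`-subset of the zeros of y. -/
theorem sum_choose_card_wordsWithZeros {m : ℕ}
    (hC : ∀ y ∈ C, y ≠ 0 → (wordSupport y)ᶜ.card ≤ m) (j : ℕ) :
    ∑ k ∈ Finset.range (m + 1), (wordsWithZeros C k).card * k.choose j =
      ∑ T ∈ Finset.powersetCard j Finset.univ, (wordsVanishingOn C T).card := by
  classical
  let D : Finset (Fin n → F) := Finset.univ.filter fun y => y ∈ C ∧ y ≠ 0
  have h1 : ∀ k, wordsWithZeros C k = D.filter fun y => (wordSupport y)ᶜ.card = k := by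
    intro k
    ext y
    simp [wordsWithZeros, D, and_assoc]
  have h2 : ∀ T, wordsVanishingOn C T =
      D.bipartiteBelow (fun y T => T ⊆ (wordSupport y)ᶜ) T := by
    intro T
    ext y
    simp [wordsVanishingOn, D, and_assoc]
  simp_rw [h2]
  rw [← Finset.sum_card_bipartiteAbove_eq_sum_card_bipartiteBelow]
  have h3 : ∀ y, ((Finset.powersetCard j Finset.univ).bipartiteAbove
      (fun (y : Fin n → F) T => T ⊆ (wordSupport y)ᶜ) y).card =
      ((wordSupport y)ᶜ.card).choose j := by
    intro y
    rw [← Finset.card_powersetCard]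
    congr 1
    ext T
    simp [Finset.mem_powersetCard, and_comm]
  simp_rw [h3]
  have hmaps : ∀ y ∈ D, (wordSupport y)ᶜ.card ∈ Finset.range (m + 1) := by
    intro y hy
    obtain ⟨hy1, hy2⟩ := (Finset.mem_filter.1 hy).2
    exact Finset.mem_range.2 (Nat.lt_succ_of_le (hC y hy1 hy2))
  rw [← Finset.sum_fiberwise_of_maps_to hmaps]
  refine Finset.sum_congr rfl fun k _ => ?_
  rw [h1, Finset.sum_congr rfl (g := fun _ => k.choose j), Finset.sum_const, smul_eq_mul]
  intro y hy
  rw [(Finset.mem_filter.1 hy).2]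

end WeightDistribution

/-! ### Weight enumerator of the dual from its binomial moments. -/

section WeightEnumerator

theorem weightDistribution_zero {F : Type*} [Field F] [DecidableEq F] {n : ℕ}
    {C : Submodule F (Fin n → F)} : weightDistribution C 0 = 1 := by
  rw [weightDistribution, Set.ncard_eq_one]
  refine ⟨0, ?_⟩
  ext c
  simp only [hammingNorm_eq_zero, Set.mem_ofPred_eq, Set.mem_singleton_iff]
  constructor
  · exact And.right
  · rintro rfl
    exact ⟨C.zero_mem, rfl⟩

variable {F : Type*} [Field F] [Fintype F] [DecidableEq F] {n : ℕ} {C : Submodule F (Fin n → F)}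

theorem cast_card_wordsVanishingOn_dualCode {q : ℕ} (hF : Fintype.card F = q)
    (hdim : Module.finrank F C + 4 = n) (hmin : ∀ c ∈ C, hammingNorm c ≤ 3 → c = 0)
    {T : Finset (Fin n)} {j k : ℕ} (hT : T.card = j) (hjk : j + k = 4) (hj : j ≤ 3) :
    ((wordsVanishingOn (dualCode C) T).card : ℚ) = (q : ℚ) ^ k - 1 := by
  have h := finrank_dualCode_inf_of_codim_four hdim T
  rw [inf_supportedWords_eq_bot hmin (hT.trans_le hj), finrank_bot, hT] at h
  have h2 := card_wordsVanishingOn (C := dualCode C) T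
  rw [show Module.finrank F (dualCode C ⊓ supportedWords F Tᶜ : Submodule F (Fin n → F)) = k by
    omega, hF] at h2
  rw [eq_sub_iff_add_eq]
  exact_mod_cast h2

theorem sum_wordsVanishingOn_dualCode {q : ℕ} (hF : Fintype.card F = q)
    (hdim : Module.finrank F C + 4 = n) (hmin : ∀ c ∈ C, hammingNorm c ≤ 3 → c = 0)
    {j k : ℕ} (hjk : j + k = 4) (hj : j ≤ 3) :
    ∑ T ∈ Finset.powersetCard j (Finset.univ : Finset (Fin n)),
      ((wordsVanishingOn (dualCode C) T).card : ℚ) = n.choose j * ((q : ℚ) ^ k - 1) := by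
  rw [Finset.sum_congr rfl fun T hT => cast_card_wordsVanishingOn_dualCode hF hdim hmin
    (Finset.mem_powersetCard.1 hT).2 hjk hj, Finset.sum_const, Finset.card_powersetCard,
    Finset.card_univ, Fintype.card_fin, nsmul_eq_mul]

theorem sum_wordsVanishingOn_dualCode_four {q : ℕ} (hF : Fintype.card F = q)
    (hdim : Module.finrank F C + 4 = n) (hmin : ∀ c ∈ C, hammingNorm c ≤ 3 → c = 0) :
    ∑ T ∈ Finset.powersetCard 4 (Finset.univ : Finset (Fin n)),
      ((wordsVanishingOn (dualCode C) T).card : ℚ) =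
      (supportBlocks C 4).ncard * ((q : ℚ) - 1) := by
  classical
  have key : ∀ T ∈ Finset.powersetCard 4 (Finset.univ : Finset (Fin n)),
      ((wordsVanishingOn (dualCode C) T).card : ℚ) =
        if T ∈ supportBlocks C 4 then (q : ℚ) - 1 else 0 := by
    intro T hT
    have hT4 := (Finset.mem_powersetCard.1 hT).2
    have h := finrank_dualCode_inf_of_codim_four hdim T
    have h2 := card_wordsVanishingOn (C := dualCode C) T
    split_ifs with hTB
    · rw [finrank_inf_supportedWords_of_mem hmin hTB, hT4] at h
      rw [show Module.finrank F (dualCode C ⊓ supportedWords F Tᶜ : Submodule F (Fin n → F)) = 1 by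
        omega, hF, pow_one] at h2
      rw [eq_sub_iff_add_eq]
      exact_mod_cast h2
    · rw [inf_supportedWords_eq_bot_of_notMem hmin hT4 hTB, finrank_bot, hT4] at h
      rw [show Module.finrank F (dualCode C ⊓ supportedWords F Tᶜ : Submodule F (Fin n → F)) = 0 by
        omega, pow_zero] at h2
      exact_mod_cast Nat.succ_injective h2
  rw [Finset.sum_congr rfl key, ← Finset.sum_filter, Finset.sum_const, nsmul_eq_mul,
    ← Set.ncard_coe_finset]
  congr 3
  ext T
  simp only [Finset.coe_filter, Finset.mem_powersetCard, Finset.subset_univ, true_and,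
    Set.mem_ofPred_eq, and_iff_right_iff_imp]
  exact card_of_mem_supportBlocks

theorem weightEnumerator_eq {m : ℕ} (hm : m < n)
    (hC : ∀ y ∈ C, y ≠ 0 → (wordSupport y)ᶜ.card ≤ m) :
    weightEnumerator C = 1 + ∑ k ∈ Finset.range (m + 1),
      Polynomial.C ((wordsWithZeros C k).card : ℚ) * X ^ (n - k) := by
  classical
  rw [weightEnumerator, Finset.sum_range_succ', weightDistribution_zero, add_comm]
  congr 1
  · simp
  -- Reindex by the number k of zeros, weight n - k; the terms with k > m are empty.
  · rw [← Finset.sum_range_reflect]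
    have h1 : ∀ k ∈ Finset.range n, Polynomial.C (weightDistribution C (n - 1 - k + 1) : ℚ) *
        X ^ (n - 1 - k + 1) = Polynomial.C ((wordsWithZeros C k).card : ℚ) * X ^ (n - k) := by
      intro k hk
      have hk' := Finset.mem_range.1 hk
      rw [show n - 1 - k + 1 = n - k by omega, weightDistribution_eq_card_wordsWithZeros hk']
    rw [Finset.sum_congr rfl h1]
    symm
    refine Finset.sum_subset (Finset.range_subset_range.2 hm) fun k _ hk => ?_
    have : wordsWithZeros C k = ∅ := by
      rw [Finset.eq_empty_iff_forall_notMem]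
      intro y hy
      obtain ⟨-, h1, h2, h3⟩ := Finset.mem_filter.1 hy
      have := hC y h1 h2
      exact hk (Finset.mem_range.2 (by omega))
    simp [this]

theorem weightEnumerator_dualCode {q : ℕ} {C : Submodule F (Fin (q + 1) → F)} (hq : 3 < q)
    (hF : Fintype.card F = q)
    (hdim : Module.finrank F C + 4 = q + 1) (hmin : ∀ c ∈ C, hammingNorm c ≤ 3 → c = 0)
    (hB : ∀ b ∈ supportBlocks C 4, ∀ b' ∈ supportBlocks C 4, 2 < (b ∩ b').card → b = b')
    (hb : ((supportBlocks C 4).ncard : ℚ) = ((q : ℚ) - 4) * q * (q + 1) / 24) :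
    weightEnumerator (dualCode C) =
      1 + Polynomial.C (((q : ℚ) - 4) * (q - 1) * q * (q + 1) / 24) * X ^ (q - 3)
        + Polynomial.C (((q : ℚ) - 1) * q * (q + 1) / 2) * X ^ (q - 2)
        + Polynomial.C (((q : ℚ) + 1) * q ^ 2 * (q - 1) / 4) * X ^ (q - 1)
        + Polynomial.C (((q : ℚ) - 1) * (q + 1) * (2 * q ^ 2 + q + 6) / 6) * X ^ q
        + Polynomial.C ((3 * (q : ℚ) ^ 4 - 4 * q ^ 3 - 3 * q ^ 2 + 4 * q) / 8) * X ^ (q + 1) := by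
  have hC : ∀ y ∈ dualCode C, y ≠ 0 → (wordSupport y)ᶜ.card ≤ 4 :=
    fun y hy hy0 => card_zeros_le_four hdim hmin hB hy hy0
  have hm : ∀ j, ∑ k ∈ Finset.range (4 + 1),
      ((wordsWithZeros (dualCode C) k).card : ℚ) * k.choose j =
      ∑ T ∈ Finset.powersetCard j Finset.univ, ((wordsVanishingOn (dualCode C) T).card : ℚ) := by
    intro j
    exact_mod_cast sum_choose_card_wordsWithZeros hC j
  rw [weightEnumerator_eq (m := 4) (by omega) hC]
  -- The binomial moments of orders 0 to 4. Those up to 3 depend only on the dimension and minimum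
  -- distance; the fourth is the number of blocks times q - 1.
  have m0 := (hm 0).trans (sum_wordsVanishingOn_dualCode (k := 4) hF hdim hmin rfl (by omega))
  have m1 := (hm 1).trans (sum_wordsVanishingOn_dualCode (k := 3) hF hdim hmin rfl (by omega))
  have m2 := (hm 2).trans (sum_wordsVanishingOn_dualCode (k := 2) hF hdim hmin rfl (by omega))
  have m3 := (hm 3).trans (sum_wordsVanishingOn_dualCode (k := 1) hF hdim hmin rfl (by omega))
  have m4 := (hm 4).trans (sum_wordsVanishingOn_dualCode_four hF hdim hmin)
  have c2 : ((q + 1).choose 2 : ℚ) = (q + 1) * q / 2 := by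
    rw [Nat.cast_choose_two]
    push_cast
    ring
  have c3 : ((q + 1).choose 3 : ℚ) = (q + 1) * (q * (q - 1) / 2) / 3 := by
    have h : ((q : ℚ) + 1) * q.choose 2 = (q + 1).choose 3 * 3 := by
      exact_mod_cast Nat.add_one_mul_choose_eq q 2
    rw [Nat.cast_choose_two] at h
    rw [h]
    ring
  rw [c2] at m2
  rw [c3] at m3
  rw [hb] at m4
  simp only [Finset.sum_range_succ, Finset.range_zero, Finset.sum_empty,
    zero_add] at m0 m1 m2 m3 m4 ⊢
  generalize ((wordsWithZeros (dualCode C) 0).card : ℚ) = N0 at *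
  generalize ((wordsWithZeros (dualCode C) 1).card : ℚ) = N1 at *
  generalize ((wordsWithZeros (dualCode C) 2).card : ℚ) = N2 at *
  generalize ((wordsWithZeros (dualCode C) 3).card : ℚ) = N3 at *
  generalize ((wordsWithZeros (dualCode C) 4).card : ℚ) = N4 at *
  norm_num [Nat.choose] at m0 m1 m2 m3 m4
  -- The system is unitriangular, so back substitution starts from four zeros.
  have e4 : N4 = ((q : ℚ) - 4) * (q - 1) * q * (q + 1) / 24 := by rw [m4]; ring
  have e3 : N3 = ((q : ℚ) - 1) * q * (q + 1) / 2 := by linear_combination m3 - 4 * e4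
  have e2 : N2 = ((q : ℚ) + 1) * q ^ 2 * (q - 1) / 4 := by
    linear_combination m2 - 3 * e3 - 6 * e4
  have e1 : N1 = ((q : ℚ) - 1) * (q + 1) * (2 * q ^ 2 + q + 6) / 6 := by
    linear_combination m1 - 2 * e2 - 3 * e3 - 4 * e4
  have e0 : N0 = (3 * (q : ℚ) ^ 4 - 4 * q ^ 3 - 3 * q ^ 2 + 4 * q) / 8 := by
    linear_combination m0 - e1 - e2 - e3 - e4
  rw [e0, e1, e2, e3, e4, show q + 1 - 0 = q + 1 by omega, show q + 1 - 1 = q by omega,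
    show q + 1 - 2 = q - 1 by omega, show q + 1 - 3 = q - 2 by omega,
    show q + 1 - 4 = q - 3 by omega]
  ring

end WeightEnumerator

/-! ### Elementary counting in 2-designs. -/

section DesignCounting

variable {P : Type*} [Fintype P] [DecidableEq P] {B : Finset (Finset P)} {v k lam : ℕ}

/-- Double count of pairs (b, j) with b a block through `i` and j another point of b. Taking v+1
points and blocks of size k+1 avoids subtraction. -/
theorem card_blocks_mem_mul (hv : Fintype.card P = v + 1) (hB : ∀ b ∈ B, b.card = k + 1)
    (hlam : ∀ i j : P, i ≠ j → (B.filter fun b => i ∈ b ∧ j ∈ b).card = lam) (i : P) :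
    (B.filter fun b => i ∈ b).card * k = v * lam := by
  have h := Finset.sum_card_bipartiteAbove_eq_sum_card_bipartiteBelow
    (s := B.filter fun b => i ∈ b) (t := Finset.univ.erase i) (fun b j => j ∈ b)
  rw [Finset.sum_congr rfl (g := fun _ => k), Finset.sum_const, smul_eq_mul] at h
  · rw [h, Finset.sum_congr rfl (g := fun _ => lam), Finset.sum_const, smul_eq_mul,
      Finset.card_erase_of_mem (Finset.mem_univ _), Finset.card_univ, hv, Nat.add_sub_cancel]
    intro j hj
    rw [← hlam i j (Finset.ne_of_mem_erase hj).symm, Finset.bipartiteBelow, Finset.filter_filter]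
  · intro b hb
    obtain ⟨hb, hi⟩ := Finset.mem_filter.1 hb
    have : (Finset.univ.erase i).bipartiteAbove (fun b j => j ∈ b) b = b.erase i := by
      ext j
      simp [Finset.bipartiteAbove]
    rw [this, Finset.card_erase_of_mem hi, hB b hb, Nat.add_sub_cancel]

theorem sum_card_blocks_mem (hB : ∀ b ∈ B, b.card = k) :
    ∑ i, (B.filter fun b => i ∈ b).card = B.card * k := by
  have h := Finset.sum_card_bipartiteAbove_eq_sum_card_bipartiteBelow
    (s := B) (t := Finset.univ) (fun b (i : P) => i ∈ b)
  rw [Finset.sum_congr rfl (g := fun _ => k), Finset.sum_const, smul_eq_mul] at h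
  · exact h.symm
  · intro b hb
    rw [← hB b hb]
    congr 1
    ext j
    simp [Finset.bipartiteAbove]

theorem card_blocks_notMem_add {P : Type*} [DecidableEq P] {B : Finset (Finset P)} (i j : P) :
    (B.filter fun b => i ∉ b ∧ j ∉ b).card + (B.filter fun b => i ∈ b).card +
      (B.filter fun b => j ∈ b).card = B.card + (B.filter fun b => i ∈ b ∧ j ∈ b).card := by
  simp only [Finset.card_filter, Finset.card_eq_sum_ones B, ← Finset.sum_add_distrib]
  refine Finset.sum_congr rfl fun b _ => ?_
  by_cases hi : i ∈ b <;> by_cases hj : j ∈ b <;> simp [hi, hj]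

end DesignCounting

/-! ### Symmetric functions of norm-one elements in characteristic two. -/

section UnitCircle

/-- `u` enumerates the elements of norm one of a quadratic extension `K` of a field `F` of
characteristic two, with conjugation `σ`; these form a group in which squaring is bijective and
cubing is injective. -/
structure IsUnitCircle {F K ι : Type*} [Field F] [Field K] [Algebra F K] (σ : K →ₐ[F] K)
    (u : ι → K) : Prop where
  two_eq_zero : (2 : K) = 0
  fixed : ∀ x, σ x = x → ∃ a : F, algebraMap F K a = x
  injective : Function.Injective u
  ne_zero : ∀ i, u i ≠ 0
  conj : ∀ i, σ (u i) = (u i)⁻¹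
  surj : ∀ x, x ≠ 0 → σ x = x⁻¹ → ∃ i, u i = x
  cube : ∀ i j, u i ^ 3 = u j ^ 3 → i = j
  sqrt : ∀ i j, ∃ k, u k ^ 2 = u i * u j

variable {F K : Type*} [Field F] [Field K] [Algebra F K] {σ : K →ₐ[F] K}

section Points

variable {ι : Type*} {u : ι → K} (h : IsUnitCircle σ u)

include h

theorem IsUnitCircle.add_self (x : K) : x + x = 0 := by
  linear_combination x * h.two_eq_zero

theorem IsUnitCircle.eq_of_sq_eq {i j : ι} (hij : u i ^ 2 = u j ^ 2) : i = j := by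
  apply h.injective
  have : (u i - u j) ^ 2 = 0 := by
    linear_combination hij + (u j ^ 2 - u i * u j) * h.two_eq_zero
  exact sub_eq_zero.1 (pow_eq_zero_iff (two_ne_zero)|>.1 this)

theorem IsUnitCircle.conj_symm_two_mul (i j k : ι) :
    σ (u i * u j + u i * u k + u j * u k) * (u i * u j * u k) = u i + u j + u k := by
  have := h.ne_zero i
  have := h.ne_zero j
  have := h.ne_zero k
  simp only [map_add, map_mul, h.conj]
  field_simp
  ring

theorem IsUnitCircle.conj_symm_one_mul (i j k : ι) :
    σ (u i + u j + u k) * (u i * u j * u k) = u i * u j + u i * u k + u j * u k := by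
  have := h.ne_zero i
  have := h.ne_zero j
  have := h.ne_zero k
  simp only [map_add, h.conj]
  field_simp
  ring

theorem IsUnitCircle.symm_one_ne_zero {i j : ι} (k : ι) (hij : i ≠ j) :
    u i + u j + u k ≠ 0 := by
  intro h1
  have h2 := h.conj_symm_one_mul i j k
  rw [h1, map_zero, zero_mul] at h2
  -- Conjugation turns e₁ = 0 into e₂ = 0; eliminating `u k` gives uᵢ² + uᵢuⱼ + uⱼ² = 0, so the
  -- cubes of `u i` and `u j` agree.
  apply hij
  apply h.cube
  linear_combination (u i - u j) * ((u i + u j) * h1 - (u i * u j) * h.two_eq_zero + h2) +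
    (u i - u j) * u i * u j * h.two_eq_zero

theorem IsUnitCircle.symm_two_ne_zero {i j : ι} (k : ι) (hij : i ≠ j) :
    u i * u j + u i * u k + u j * u k ≠ 0 := by
  intro h2
  have h1 := h.conj_symm_two_mul i j k
  rw [h2, map_zero, zero_mul] at h1
  exact h.symm_one_ne_zero k hij h1.symm

/-- The second elementary symmetric function of three points and a fourth one vanishes for exactly
one choice of the fourth point. -/
theorem IsUnitCircle.exists_fourth {i j : ι} (k : ι) (hij : i ≠ j) :
    ∃ l, u i * u j + u i * u k + u j * u k + (u i + u j + u k) * u l = 0 := by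
  have h1 := h.symm_one_ne_zero k hij
  have h2 := h.symm_two_ne_zero k hij
  have h3 : u i * u j * u k ≠ 0 :=
    mul_ne_zero (mul_ne_zero (h.ne_zero i) (h.ne_zero j)) (h.ne_zero k)
  have c1 := eq_div_of_mul_eq h3 (h.conj_symm_one_mul i j k)
  have c2 := eq_div_of_mul_eq h3 (h.conj_symm_two_mul i j k)
  -- Conjugation sends e₁ to e₂/e₃ and e₂ to e₁/e₃, so e₂/e₁ is inverted.
  obtain ⟨l, hl⟩ := h.surj ((u i * u j + u i * u k + u j * u k) / (u i + u j + u k))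
    (div_ne_zero h2 h1) (by
      rw [map_div₀, c1, c2, div_div_div_cancel_right₀ h3, inv_div])
  refine ⟨l, ?_⟩
  rw [hl, mul_div_cancel₀ _ h1, h.add_self]

theorem IsUnitCircle.fourth_unique {i j k l l' : ι} (hij : i ≠ j)
    (h1 : u i * u j + u i * u k + u j * u k + (u i + u j + u k) * u l = 0)
    (h2 : u i * u j + u i * u k + u j * u k + (u i + u j + u k) * u l' = 0) : l = l' := by
  apply h.injective
  apply mul_left_cancel₀ (h.symm_one_ne_zero k hij)
  linear_combination h1 - h2

/-- The fourth point attached to three distinct points is distinct from them unless one of the three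
points is the geometric mean of the other two. -/
theorem IsUnitCircle.fourth_ne_iff {i j k : ι} (hij : i ≠ j) {l : ι}
    (hl : u i * u j + u i * u k + u j * u k + (u i + u j + u k) * u l = 0) :
    (l ≠ i ∧ l ≠ j ∧ l ≠ k) ↔
      (u i ^ 2 ≠ u j * u k ∧ u j ^ 2 ≠ u i * u k ∧ u k ^ 2 ≠ u i * u j) := by
  have key : ∀ m, l = m ↔
      u i * u j + u i * u k + u j * u k + (u i + u j + u k) * u m = 0 := by
    intro m
    constructor
    · rintro rfl
      exact hl
    · exact fun hm => h.fourth_unique hij hl hm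
  refine and_congr (not_congr ((key _).trans ?_)) (and_congr (not_congr ((key _).trans ?_))
    (not_congr ((key _).trans ?_)))
  · constructor <;> intro hm
    · linear_combination hm - (u i * u j + u i * u k + u j * u k) * h.two_eq_zero
    · linear_combination hm + (u i * u j + u i * u k + u j * u k) * h.two_eq_zero
  · constructor <;> intro hm
    · linear_combination hm - (u i * u j + u i * u k + u j * u k) * h.two_eq_zero
    · linear_combination hm + (u i * u j + u i * u k + u j * u k) * h.two_eq_zero
  · constructor <;> intro hm
    · linear_combination hm - (u i * u j + u i * u k + u j * u k) * h.two_eq_zero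
    · linear_combination hm + (u i * u j + u i * u k + u j * u k) * h.two_eq_zero

theorem IsUnitCircle.exists_sq_eq_mul (i j : ι) : ∃ k, u i ^ 2 = u j * u k := by
  have := h.ne_zero i
  have := h.ne_zero j
  obtain ⟨k, hk⟩ := h.surj (u i ^ 2 / u j) (by positivity) (by
    rw [map_div₀, map_pow, h.conj, h.conj]
    field_simp)
  refine ⟨k, ?_⟩
  rw [hk]
  field_simp

/-- The number of points that together with two given ones determine a fourth point distinct from
all three. -/
theorem IsUnitCircle.card_good [Fintype ι] [DecidableEq ι] [DecidableEq K] {i j : ι} (hij : i ≠ j) :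
    (Finset.univ.filter fun k => (k ≠ i ∧ k ≠ j) ∧
      (u i ^ 2 ≠ u j * u k ∧ u j ^ 2 ≠ u i * u k ∧ u k ^ 2 ≠ u i * u j)).card + 5 =
      Fintype.card ι := by
  -- The bad third points are i, j, uᵢ²/uⱼ, uⱼ²/uᵢ and the square root of uᵢuⱼ.
  obtain ⟨a, ha⟩ := h.exists_sq_eq_mul i j
  obtain ⟨b, hb⟩ := h.exists_sq_eq_mul j i
  obtain ⟨c, hc⟩ := h.sqrt i j
  have hi := h.ne_zero i
  have hj := h.ne_zero j
  have ha' : ∀ k, u i ^ 2 = u j * u k ↔ k = a := fun k =>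
    ⟨fun hk => h.injective (mul_left_cancel₀ hj (hk.symm.trans ha)), fun hk => hk ▸ ha⟩
  have hb' : ∀ k, u j ^ 2 = u i * u k ↔ k = b := fun k =>
    ⟨fun hk => h.injective (mul_left_cancel₀ hi (hk.symm.trans hb)), fun hk => hk ▸ hb⟩
  have hc' : ∀ k, u k ^ 2 = u i * u j ↔ k = c := fun k =>
    ⟨fun hk => h.eq_of_sq_eq (hk.trans hc.symm), fun hk => hk ▸ hc⟩
  have hai : a ≠ i := by
    rintro rfl
    exact hij (h.injective (mul_right_cancel₀ hi (by rw [← ha, sq])))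
  have haj : a ≠ j := by
    rintro rfl
    exact hij (h.eq_of_sq_eq (by rw [ha, sq]))
  have hbi : b ≠ i := by
    rintro rfl
    exact hij (h.eq_of_sq_eq (by rw [hb, sq]))
  have hbj : b ≠ j := by
    rintro rfl
    exact hij (h.injective (mul_right_cancel₀ hj (by rw [← hb, sq])))
  have hci : c ≠ i := by
    rintro rfl
    exact hij (h.injective (mul_left_cancel₀ hi (by rw [← hc, sq])))
  have hcj : c ≠ j := by
    rintro rfl
    exact hij (h.injective (mul_right_cancel₀ hj (by rw [← hc, sq])))
  -- Any coincidence among a, b, c would make the cubes of `u i` and `u j` equal.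
  have hab : a ≠ b := by
    rintro rfl
    exact hij (h.cube _ _ (by linear_combination u i * ha - u j * hb))
  have hac : a ≠ c := by
    rintro rfl
    exact hij (h.cube _ _ (mul_left_cancel₀ hi (by
      linear_combination (u i ^ 2 + u j * u a) * ha + u j ^ 2 * hc)))
  have hbc : b ≠ c := by
    rintro rfl
    exact hij (h.cube _ _ (mul_left_cancel₀ hj (by
      linear_combination -(u j ^ 2 + u i * u b) * hb - u i ^ 2 * hc)))
  have hcard : ({i, j, a, b, c} : Finset ι).card = 5 := by
    rw [Finset.card_insert_of_notMem, Finset.card_insert_of_notMem, Finset.card_insert_of_notMem,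
      Finset.card_insert_of_notMem, Finset.card_singleton] <;>
    simp [*, hai.symm, haj.symm, hbi.symm, hbj.symm, hci.symm, hcj.symm]
  rw [← hcard, ← Finset.card_compl_add_card ({i, j, a, b, c} : Finset ι)]
  congr 2
  ext k
  simp only [ne_eq, ha', hb', hc', Finset.mem_filter, Finset.mem_univ, true_and, Finset.mem_compl,
    Finset.mem_insert, Finset.mem_singleton]
  tauto

end Points

end UnitCircle

/-! ### The code with quadratic checks: distance, dimension, weight-4 words. -/

section UnitCircleCode

variable {F K : Type*} [Field F] [Field K] [Algebra F K] {σ : K →ₐ[F] K}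
variable {n : ℕ} {u : Fin n → K} {C : Submodule F (Fin n → F)}

/-- `C` is the code with parity checks `c ↦ ∑ cᵢ uᵢ` and `c ↦ ∑ cᵢ uᵢ²`. -/
def HasQuadraticChecks (C : Submodule F (Fin n → F)) (u : Fin n → K) : Prop :=
  ∀ c, c ∈ C ↔ ∑ i, algebraMap F K (c i) * u i = 0 ∧ ∑ i, algebraMap F K (c i) * u i ^ 2 = 0

/-- Conjugation fixes the coefficients cᵢ and inverts uᵢ, so exponents -2, -1, 1, 2 all give checks;
exponent 0, the x² term of the quartic, is missing. -/
theorem IsUnitCircle.sum_mul_eq_zero (h : IsUnitCircle σ u) (hC : HasQuadraticChecks C u)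
    {c : Fin n → F} (hc : c ∈ C) (a₀ a₁ a₃ a₄ : K) :
    ∑ i, algebraMap F K (c i) *
      ((u i)⁻¹ ^ 2 * (a₀ + a₁ * u i + a₃ * u i ^ 3 + a₄ * u i ^ 4)) = 0 := by
  obtain ⟨h1, h2⟩ := (hC c).1 hc
  have h1' := congrArg σ h1
  have h2' := congrArg σ h2
  simp only [map_sum, map_mul, AlgHom.commutes, map_pow, h.conj, map_zero] at h1' h2'
  calc _ = a₀ * ∑ i, algebraMap F K (c i) * (u i)⁻¹ ^ 2 + a₁ * ∑ i, algebraMap F K (c i) * (u i)⁻¹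
        + a₃ * ∑ i, algebraMap F K (c i) * u i + a₄ * ∑ i, algebraMap F K (c i) * u i ^ 2 := by
        simp only [Finset.mul_sum, ← Finset.sum_add_distrib]
        refine Finset.sum_congr rfl fun i _ => ?_
        have := h.ne_zero i
        field_simp
    _ = 0 := by rw [h1, h2, h1', h2']; ring

/-- If the roots of an admissible polynomial cover the rest of the support, its check has a single
surviving term. -/
theorem IsUnitCircle.apply_eq_zero (h : IsUnitCircle σ u) (hC : HasQuadraticChecks C u)
    {c : Fin n → F} (hc : c ∈ C) (a₀ a₁ a₃ a₄ : K) {i : Fin n}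
    (hz : ∀ l ≠ i, c l = 0 ∨ a₀ + a₁ * u l + a₃ * u l ^ 3 + a₄ * u l ^ 4 = 0)
    (hi : a₀ + a₁ * u i + a₃ * u i ^ 3 + a₄ * u i ^ 4 ≠ 0) : c i = 0 := by
  have hs := h.sum_mul_eq_zero hC hc a₀ a₁ a₃ a₄
  rw [Finset.sum_eq_single i] at hs
  · simpa [hi, h.ne_zero i] using hs
  · rintro l - hl
    rcases hz l hl with h0 | h0 <;> simp [h0]
  · simp

theorem IsUnitCircle.eq_zero_of_hammingNorm_le [DecidableEq F] (h : IsUnitCircle σ u)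
    (hn : 3 ≤ n) (hC : HasQuadraticChecks C u) :
    ∀ c ∈ C, hammingNorm c ≤ 3 → c = 0 := by
  intro c hc hc3
  by_contra hne
  obtain ⟨i, hi⟩ := Function.ne_iff.1 hne
  obtain ⟨T, hcT, hT⟩ := Finset.exists_superset_card_eq (s := wordSupport c) (n := 3) hc3
    (by simpa using hn)
  have hiT : i ∈ T := hcT (mem_wordSupport.2 hi)
  obtain ⟨j, k, hjk, hE⟩ := Finset.card_eq_two.1
    (show (T.erase i).card = 2 by rw [Finset.card_erase_of_mem hiT, hT])
  have hj : j ≠ i := Finset.ne_of_mem_erase (s := T) (hE ▸ by simp)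
  have hk : k ≠ i := Finset.ne_of_mem_erase (s := T) (hE ▸ by simp)
  -- The cubic (x - uⱼ)(x - uₖ)(x + uⱼ + uₖ), whose third root is chosen to cancel the x² term.
  refine hi (h.apply_eq_zero hC hc (u j * u k * (u j + u k)) (u j * u k - (u j + u k) ^ 2) 1 0
    ?_ ?_)
  · intro l hl
    by_cases hlE : l ∈ ({j, k} : Finset (Fin n))
    · right
      rcases Finset.mem_insert.1 hlE with rfl | hlE
      · ring
      · rw [Finset.mem_singleton.1 hlE]
        ring
    · left
      by_contra hcl
      rw [← hE] at hlE
      exact hlE (Finset.mem_erase.2 ⟨hl, hcT (mem_wordSupport.2 hcl)⟩)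
  · have h1 := sub_ne_zero.2 (h.injective.ne hj)
    have h2 := sub_ne_zero.2 (h.injective.ne hk)
    have h3 := h.symm_one_ne_zero k hj
    convert mul_ne_zero (mul_ne_zero h1 h2) h3 using 1
    ring

theorem IsUnitCircle.symm_two_eq_zero_of_mem [DecidableEq F] (h : IsUnitCircle σ u)
    (hC : HasQuadraticChecks C u) {i j k l : Fin n} (hil : l ≠ i) (hjl : l ≠ j) (hkl : l ≠ k)
    (hb : {i, j, k, l} ∈ supportBlocks C 4) :
    u i * u j + u i * u k + u j * u k + (u i + u j + u k) * u l = 0 := by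
  by_contra hne
  obtain ⟨c, hc, -, hsupp⟩ := hb
  have hcl : c l ≠ 0 := mem_wordSupport.1 (hsupp ▸ by simp)
  have hout : ∀ m, m ≠ i → m ≠ j → m ≠ k → m ≠ l → c m = 0 := by
    intro m h1 h2 h3 h4
    by_contra hm
    have := mem_wordSupport.2 hm
    rw [hsupp] at this
    simp [h1, h2, h3, h4] at this
  -- The quartic (x - uᵢ)(x - uⱼ)(x - uₖ)(e₁x + e₂), with e₁, e₂ taken at i, j, k; its last factor
  -- cancels the x² term.
  refine hcl (h.apply_eq_zero hC hc
    (-(u i * u j + u i * u k + u j * u k) * (u i * u j * u k))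
    ((u i * u j + u i * u k + u j * u k) ^ 2 - (u i + u j + u k) * (u i * u j * u k))
    (u i * u j + u i * u k + u j * u k - (u i + u j + u k) ^ 2)
    (u i + u j + u k) ?_ ?_)
  · intro m hm
    by_cases h1 : m = i
    · subst h1; right; ring
    by_cases h2 : m = j
    · subst h2; right; ring
    by_cases h3 : m = k
    · subst h3; right; ring
    exact Or.inl (hout m h1 h2 h3 hm)
  · have h1 := sub_ne_zero.2 (h.injective.ne hil)
    have h2 := sub_ne_zero.2 (h.injective.ne hjl)
    have h3 := sub_ne_zero.2 (h.injective.ne hkl)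
    convert mul_ne_zero (mul_ne_zero (mul_ne_zero h1 h2) h3) hne using 1
    ring

/-- Explicit Hilbert 90: b = 1 + e⁻¹ has conjugate 1 + e = be, and vanishes only for e = 1, where b
= 1 serves. -/
theorem IsUnitCircle.exists_conj_eq_mul (h : IsUnitCircle σ u) {e : K} (he : e ≠ 0)
    (hσ : σ e = e⁻¹) : ∃ b : K, b ≠ 0 ∧ σ b = b * e := by
  by_cases h1 : e = 1
  · exact ⟨1, one_ne_zero, by simp [h1]⟩
  · refine ⟨1 + e⁻¹, ?_, ?_⟩
    · intro h0
      apply h1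
      field_simp at h0
      linear_combination h0 - h.two_eq_zero
    · rw [map_add, map_one, map_inv₀, hσ]
      field_simp
      ring

/-- Four points whose second elementary symmetric function vanishes are the zeros of a word of the
dual code. -/
theorem IsUnitCircle.exists_dualCode (h : IsUnitCircle σ u) (hC : HasQuadraticChecks C u)
    (hn : 4 < n) {i j k l : Fin n}
    (he : u i * u j + u i * u k + u j * u k + (u i + u j + u k) * u l = 0) :
    ∃ y ∈ dualCode C, y ≠ 0 ∧ y i = 0 ∧ y j = 0 ∧ y k = 0 ∧ y l = 0 := by
  have hi := h.ne_zero i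
  have hj := h.ne_zero j
  have hk := h.ne_zero k
  have hl := h.ne_zero l
  obtain ⟨b, hb, hσb⟩ := h.exists_conj_eq_mul (e := u i * u j * u k * u l)
    (mul_ne_zero (mul_ne_zero (mul_ne_zero hi hj) hk) hl) (by
      simp only [map_mul, h.conj, mul_inv])
  let e₁ := u i + u j + u k + u l
  let e₃ := u i * u j * u k + u i * u j * u l + u i * u k * u l + u j * u k * u l
  let e₄ := u i * u j * u k * u l
  let f : Fin n → K := fun m =>
    (u m)⁻¹ ^ 2 * (b * e₄ + b * e₃ * u m + b * e₁ * u m ^ 3 + b * u m ^ 4)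
  -- Conjugation reverses the quartic up to the factor e₄⁻¹, which σ b = b e₄ compensates.
  have hfix : ∀ m, σ (f m) = f m := by
    intro m
    have hm := h.ne_zero m
    simp only [f, e₁, e₃, e₄, map_mul, map_add, map_pow, map_inv₀, h.conj, hσb]
    field_simp
    ring
  have hf : ∀ m, f m = (u m)⁻¹ ^ 2 * b *
      ((u m + u i) * (u m + u j) * (u m + u k) * (u m + u l)) := by
    intro m
    simp only [f, e₁, e₃, e₄]
    linear_combination -(u m)⁻¹ ^ 2 * b * u m ^ 2 * he
  choose y hy using fun m => h.fixed _ (hfix m)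
  have hy0 : ∀ m, f m = 0 → y m = 0 := by
    intro m hm
    rw [← hy] at hm
    exact (map_eq_zero _).1 hm
  refine ⟨y, ?_, ?_, hy0 _ ?_, hy0 _ ?_, hy0 _ ?_, hy0 _ ?_⟩
  · intro x hx
    apply (algebraMap F K).injective
    rw [map_zero, dotProduct, map_sum, ← h.sum_mul_eq_zero hC hx (b * e₄) (b * e₃) (b * e₁) b]
    refine Finset.sum_congr rfl fun m _ => ?_
    rw [map_mul, hy]
  · obtain ⟨m, -, hm⟩ := Finset.exists_mem_notMem_of_card_lt_card
      (s := {i, j, k, l}) (t := (Finset.univ : Finset (Fin n)))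
      (Finset.card_le_four.trans_lt (by simpa using hn))
    simp only [Finset.mem_insert, Finset.mem_singleton, not_or] at hm
    obtain ⟨h1, h2, h3, h4⟩ := hm
    have hadd : ∀ t, m ≠ t → u m + u t ≠ 0 := by
      intro t ht h0
      exact ht (h.injective (by linear_combination h0 - u t * h.two_eq_zero))
    intro hy'
    have := hy m
    rw [hy', Pi.zero_apply, map_zero, hf] at this
    exact mul_ne_zero (mul_ne_zero (pow_ne_zero _ (inv_ne_zero (h.ne_zero m))) hb)
      (mul_ne_zero (mul_ne_zero (mul_ne_zero (hadd i h1) (hadd j h2)) (hadd k h3)) (hadd l h4))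
      this.symm
  all_goals
    rw [hf, h.add_self]
    ring

theorem IsUnitCircle.exists_four [DecidableEq K] (h : IsUnitCircle σ u) (hn : 5 < n) :
    ∃ i j k l : Fin n, i ≠ j ∧ (k ≠ i ∧ k ≠ j) ∧ (l ≠ i ∧ l ≠ j ∧ l ≠ k) ∧
      u i * u j + u i * u k + u j * u k + (u i + u j + u k) * u l = 0 := by
  have hij : (⟨0, by omega⟩ : Fin n) ≠ ⟨1, by omega⟩ := by simp
  have hg := h.card_good hij
  rw [Fintype.card_fin] at hg
  obtain ⟨k, hk⟩ := Finset.card_pos.1 (Nat.pos_of_ne_zero fun h0 => by rw [h0] at hg; omega)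
  obtain ⟨-, hk, hk'⟩ := Finset.mem_filter.1 hk
  obtain ⟨l, hl⟩ := h.exists_fourth k hij
  exact ⟨_, _, k, l, hij, hk, (h.fourth_ne_iff hij hl).2 hk', hl⟩

theorem IsUnitCircle.finrank_add_four (h : IsUnitCircle σ u) (hn : 5 < n)
    (hC : HasQuadraticChecks C u) (hK : Module.finrank F K = 2) :
    Module.finrank F C + 4 = n := by
  classical
  have : Module.Finite F K := Module.finite_of_finrank_eq_succ hK
  apply le_antisymm
  -- A nonzero dual word vanishing on three coordinates, where `C` has no nonzero word, forces
  -- codimension at least 4.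
  · obtain ⟨i, j, k, l, hij, ⟨hki, hkj⟩, -, he⟩ := h.exists_four hn
    obtain ⟨y, hy, hy0, hyi, hyj, hyk, -⟩ := h.exists_dualCode hC (by omega) he
    have hT : ({i, j, k} : Finset (Fin n)).card = 3 :=
      Finset.card_eq_three.2 ⟨i, j, k, hij, hki.symm, hkj.symm, rfl⟩
    have hfin := finrank_dualCode_inf C {i, j, k}
    rw [inf_supportedWords_eq_bot (h.eq_zero_of_hammingNorm_le (by omega) hC) hT.le, finrank_bot,
      hT] at hfin
    have hmem : y ∈ dualCode C ⊓ supportedWords F ({i, j, k} : Finset (Fin n))ᶜ := by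
      refine ⟨hy, fun m hm => ?_⟩
      rw [Finset.mem_compl, not_not] at hm
      simp only [Finset.mem_insert, Finset.mem_singleton] at hm
      rcases hm with rfl | rfl | rfl <;> assumption
    have hpos : Module.finrank F
        (dualCode C ⊓ supportedWords F ({i, j, k} : Finset (Fin n))ᶜ :
          Submodule F (Fin n → F)) ≠ 0 := by
      intro h0
      rw [Submodule.finrank_eq_zero.1 h0, Submodule.mem_bot] at hmem
      exact hy0 hmem
    omega
  -- The two checks take values in K × K, of dimension 4 over F.
  · let Φ := Fintype.linearCombination F (fun i => (u i, u i ^ 2) : Fin n → K × K)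
    have hker : C = LinearMap.ker Φ := by
      ext c
      rw [hC, LinearMap.mem_ker, Fintype.linearCombination_apply, Prod.ext_iff, Prod.fst_sum,
        Prod.snd_sum]
      simp [Algebra.smul_def]
    have h1 := LinearMap.finrank_range_add_finrank_ker Φ
    have h2 := Submodule.finrank_le (LinearMap.range Φ)
    rw [← hker, Module.finrank_fin_fun] at h1
    rw [Module.finrank_prod, hK] at h2
    omega

/-- If e₂ vanishes, there is a nonzero dual word with these four zeros, which is impossible off the
blocks. -/
theorem IsUnitCircle.mem_supportBlocks_iff [DecidableEq F] (h : IsUnitCircle σ u) (hn : 5 < n)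
    (hC : HasQuadraticChecks C u) (hK : Module.finrank F K = 2) {i j k l : Fin n}
    (hij : i ≠ j) (hki : k ≠ i) (hkj : k ≠ j) (hli : l ≠ i) (hlj : l ≠ j) (hlk : l ≠ k) :
    {i, j, k, l} ∈ supportBlocks C 4 ↔
      u i * u j + u i * u k + u j * u k + (u i + u j + u k) * u l = 0 := by
  refine ⟨h.symm_two_eq_zero_of_mem hC hli hlj hlk, fun he => ?_⟩
  obtain ⟨y, hy, hy0, hyi, hyj, hyk, hyl⟩ := h.exists_dualCode hC (by omega) he
  have hcard : ({i, j, k, l} : Finset (Fin n)).card = 4 := by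
    rw [Finset.card_insert_of_notMem, Finset.card_eq_three.2 ⟨j, k, l, hkj.symm, hlj.symm,
      hlk.symm, rfl⟩]
    simp [hij, hki.symm, hli.symm]
  by_contra hb
  refine hy0 (eq_zero_of_notMem_supportBlocks (h.finrank_add_four hn hC hK)
    (h.eq_zero_of_hammingNorm_le (by omega) hC) hcard hb hy ?_)
  intro m hm
  rw [Finset.mem_compl, mem_wordSupport, not_not]
  simp only [Finset.mem_insert, Finset.mem_singleton] at hm
  rcases hm with rfl | rfl | rfl | rfl <;> assumption

theorem exists_eq_insert_of_card_eq_four {ι : Type*} [DecidableEq ι] {b : Finset ι} {i j k : ι}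
    (hb : b.card = 4) (hi : i ∈ b) (hj : j ∈ b) (hk : k ∈ b) (hij : i ≠ j) (hki : k ≠ i)
    (hkj : k ≠ j) : ∃ l, l ≠ i ∧ l ≠ j ∧ l ≠ k ∧ b = {i, j, k, l} := by
  have h3 : (((b.erase i).erase j).erase k).card = 1 := by
    rw [Finset.card_erase_of_mem (by simp [*]), Finset.card_erase_of_mem (by simp [*, hij.symm]),
      Finset.card_erase_of_mem hi, hb]
  obtain ⟨l, hl⟩ := Finset.card_eq_one.1 h3
  have hl' : l ∈ ((b.erase i).erase j).erase k := by simp [hl]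
  simp only [Finset.mem_erase] at hl'
  obtain ⟨h1, h2, h3, h4⟩ := hl'
  refine ⟨l, h3, h2, h1, ?_⟩
  rw [← hl, Finset.insert_erase (by simp [*]), Finset.insert_erase (by simp [*, hij.symm]),
    Finset.insert_erase hi]

theorem IsUnitCircle.block_ext [DecidableEq F] (h : IsUnitCircle σ u)
    (hC : HasQuadraticChecks C u) :
    ∀ b ∈ supportBlocks C 4, ∀ b' ∈ supportBlocks C 4, 2 < (b ∩ b').card → b = b' := by
  intro b hb b' hb' hlt
  obtain ⟨i, hi, j, hj, k, hk, hij, hik, hjk⟩ := Finset.two_lt_card.1 hlt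
  rw [Finset.mem_inter] at hi hj hk
  obtain ⟨l, h1, h2, h3, rfl⟩ := exists_eq_insert_of_card_eq_four (card_of_mem_supportBlocks hb)
    hi.1 hj.1 hk.1 hij hik.symm hjk.symm
  obtain ⟨l', h1', h2', h3', rfl⟩ := exists_eq_insert_of_card_eq_four
    (card_of_mem_supportBlocks hb') hi.2 hj.2 hk.2 hij hik.symm hjk.symm
  rw [h.fourth_unique hij (h.symm_two_eq_zero_of_mem hC h1 h2 h3 hb)
    (h.symm_two_eq_zero_of_mem hC h1' h2' h3' hb')]

end UnitCircleCode

/-! ### The two designs and their parameters. -/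

section UnitCircleDesign

variable {F K : Type*} [Field F] [DecidableEq F] [Field K] [Algebra F K] {σ : K →ₐ[F] K}
variable {n : ℕ} {u : Fin n → K} {C : Submodule F (Fin n → F)}

open Classical in
/-- The supports of the words of weight `w`, as a `Finset`. -/
noncomputable def supportBlocksFinset (C : Submodule F (Fin n → F)) (w : ℕ) :
    Finset (Finset (Fin n)) :=
  Finset.univ.filter fun b => b ∈ supportBlocks C w

theorem mem_supportBlocksFinset {w : ℕ} {b : Finset (Fin n)} :
    b ∈ supportBlocksFinset C w ↔ b ∈ supportBlocks C w := by
  simp [supportBlocksFinset]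

theorem ncard_supportBlocks_sep {w : ℕ} (p : Finset (Fin n) → Prop) [DecidablePred p] :
    {b ∈ supportBlocks C w | p b}.ncard = ((supportBlocksFinset C w).filter p).card := by
  rw [← Set.ncard_coe_finset]
  congr 1
  ext b
  simp [mem_supportBlocksFinset]

theorem ncard_supportBlocks {w : ℕ} :
    (supportBlocks C w).ncard = (supportBlocksFinset C w).card := by
  rw [← Set.ncard_coe_finset]
  congr 1
  ext b
  simp [mem_supportBlocksFinset]

/-- Each block through i and j has two further points, and each good third point lies in exactly one
such block, each bad one in none. -/
theorem IsUnitCircle.card_blocks_pair (h : IsUnitCircle σ u) (hn : 5 < n)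
    (hC : HasQuadraticChecks C u) (hK : Module.finrank F K = 2) {i j : Fin n} (hij : i ≠ j) :
    ((supportBlocksFinset C 4).filter fun b => i ∈ b ∧ j ∈ b).card * 2 + 5 = n := by
  classical
  refine Eq.trans (congrArg (· + 5) ?_) ((h.card_good hij).trans (Fintype.card_fin n))
  have hdc := Finset.sum_card_bipartiteAbove_eq_sum_card_bipartiteBelow
    (s := (supportBlocksFinset C 4).filter fun b => i ∈ b ∧ j ∈ b)
    (t := Finset.univ.filter fun k => k ≠ i ∧ k ≠ j) (fun b k => k ∈ b)
  rw [Finset.sum_congr rfl (g := fun _ => 2), Finset.sum_const, smul_eq_mul] at hdc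
  · rw [hdc, ← Finset.filter_filter (fun k => k ≠ i ∧ k ≠ j), Finset.card_filter]
    refine Finset.sum_congr rfl fun k hk => ?_
    obtain ⟨hki, hkj⟩ := (Finset.mem_filter.1 hk).2
    rw [Finset.bipartiteBelow, Finset.filter_filter]
    obtain ⟨l, hl⟩ := h.exists_fourth k hij
    have hl' := h.fourth_ne_iff hij hl
    split_ifs with hg
    · obtain ⟨h1, h2, h3⟩ := hl'.2 hg
      rw [Finset.card_eq_one]
      refine ⟨{i, j, k, l}, ?_⟩
      have hblock := (h.mem_supportBlocks_iff hn hC hK hij hki hkj h1 h2 h3).2 hl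
      ext b
      rw [Finset.mem_filter, mem_supportBlocksFinset, Finset.mem_singleton]
      constructor
      · rintro ⟨hb, ⟨hi, hj⟩, hk⟩
        refine h.block_ext hC b hb _ hblock (Finset.two_lt_card.2
          ⟨i, ?_, j, ?_, k, ?_, hij, hki.symm, hkj.symm⟩) <;> simp [hi, hj, hk]
      · rintro rfl
        exact ⟨hblock, by simp⟩
    · rw [Finset.card_eq_zero, Finset.eq_empty_iff_forall_notMem]
      intro b hb
      rw [Finset.mem_filter, mem_supportBlocksFinset] at hb
      obtain ⟨hb, ⟨hi, hj⟩, hk⟩ := hb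
      obtain ⟨m, h1, h2, h3, rfl⟩ := exists_eq_insert_of_card_eq_four
        (card_of_mem_supportBlocks hb) hi hj hk hij hki hkj
      have hm := h.symm_two_eq_zero_of_mem hC h1 h2 h3 hb
      obtain rfl := h.fourth_unique hij hl hm
      exact hg (hl'.1 ⟨h1, h2, h3⟩)
  · intro b hb
    rw [Finset.mem_filter, mem_supportBlocksFinset] at hb
    obtain ⟨hb, hi, hj⟩ := hb
    have : (Finset.univ.filter fun k => k ≠ i ∧ k ≠ j).bipartiteAbove (fun b k => k ∈ b) b =
        (b.erase i).erase j := by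
      ext k
      simp [Finset.bipartiteAbove]
      tauto
    rw [this, Finset.card_erase_of_mem (by simp [hj, hij.symm]), Finset.card_erase_of_mem hi,
      card_of_mem_supportBlocks hb]

theorem IsUnitCircle.supportBlocks_nonempty (h : IsUnitCircle σ u) (hn : 5 < n)
    (hC : HasQuadraticChecks C u) (hK : Module.finrank F K = 2) :
    (supportBlocks C 4).Nonempty := by
  classical
  obtain ⟨i, j, k, l, hij, ⟨hki, hkj⟩, ⟨h1, h2, h3⟩, he⟩ := h.exists_four hn
  exact ⟨_, (h.mem_supportBlocks_iff hn hC hK hij hki hkj h1 h2 h3).2 he⟩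

variable {q : ℕ} {v : Fin (q + 1) → K} {D : Submodule F (Fin (q + 1) → F)}

theorem IsUnitCircle.cast_card_blocks_pair (h : IsUnitCircle σ v) (hq : 4 < q)
    (hD : HasQuadraticChecks D v) (hK : Module.finrank F K = 2) {i j : Fin (q + 1)} (hij : i ≠ j) :
    (((supportBlocksFinset D 4).filter fun b => i ∈ b ∧ j ∈ b).card : ℚ) = ((q : ℚ) - 4) / 2 := by
  have := h.card_blocks_pair (by omega) hD hK hij
  have : (((supportBlocksFinset D 4).filter fun b => i ∈ b ∧ j ∈ b).card : ℚ) * 2 + 4 = q := by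
    exact_mod_cast (by omega :
      ((supportBlocksFinset D 4).filter fun b => i ∈ b ∧ j ∈ b).card * 2 + 4 = q)
  linarith

theorem IsUnitCircle.cast_card_blocks_mem (h : IsUnitCircle σ v) (hq : 4 < q)
    (hD : HasQuadraticChecks D v) (hK : Module.finrank F K = 2) (i : Fin (q + 1)) :
    (((supportBlocksFinset D 4).filter fun b => i ∈ b).card : ℚ) = ((q : ℚ) - 4) * q / 6 := by
  have h1 := card_blocks_mem_mul (B := supportBlocksFinset D 4) (v := q) (k := 3)
    (lam := (q - 4) / 2) (by simp)
    (fun b hb => card_of_mem_supportBlocks (mem_supportBlocksFinset.1 hb))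
    (fun i j hij => by have := h.card_blocks_pair (by omega) hD hK hij; omega) i
  -- The natural-number division is exact because twice a pair count is q - 4.
  have h2 : (((q - 4) / 2 : ℕ) : ℚ) = ((q : ℚ) - 4) / 2 := by
    rw [← h.cast_card_blocks_pair hq hD hK (i := 0) (j := Fin.last q)
      (by rw [Ne, Fin.ext_iff, Fin.val_zero, Fin.val_last]; omega)]
    norm_cast
    have := h.card_blocks_pair (by omega) hD hK (i := 0) (j := Fin.last q)
      (by rw [Ne, Fin.ext_iff, Fin.val_zero, Fin.val_last]; omega)
    omega
  have h3 : (((supportBlocksFinset D 4).filter fun b => i ∈ b).card : ℚ) * 3 =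
      q * (((q - 4) / 2 : ℕ) : ℚ) := by exact_mod_cast h1
  rw [h2] at h3
  linarith

theorem IsUnitCircle.cast_card_blocks (h : IsUnitCircle σ v) (hq : 4 < q)
    (hD : HasQuadraticChecks D v) (hK : Module.finrank F K = 2) :
    ((supportBlocksFinset D 4).card : ℚ) = ((q : ℚ) - 4) * q * (q + 1) / 24 := by
  have h1 := sum_card_blocks_mem (B := supportBlocksFinset D 4) (k := 4)
    (fun b hb => card_of_mem_supportBlocks (mem_supportBlocksFinset.1 hb))
  have h2 : ∑ i, (((supportBlocksFinset D 4).filter fun b => i ∈ b).card : ℚ) =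
      (supportBlocksFinset D 4).card * 4 := by exact_mod_cast h1
  rw [Finset.sum_congr rfl fun i _ => h.cast_card_blocks_mem hq hD hK i, Finset.sum_const,
    Finset.card_univ, Fintype.card_fin, nsmul_eq_mul] at h2
  push_cast at h2
  linarith

/-- Inclusion-exclusion: all blocks, minus those through each point, plus those through both. -/
theorem IsUnitCircle.cast_card_blocks_notMem (h : IsUnitCircle σ v) (hq : 4 < q)
    (hD : HasQuadraticChecks D v) (hK : Module.finrank F K = 2) {i j : Fin (q + 1)} (hij : i ≠ j) :
    (((supportBlocksFinset D 4).filter fun b => i ∉ b ∧ j ∉ b).card : ℚ) =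
      ((q : ℚ) - 4) ^ 2 * (q - 3) / 24 := by
  have h1 := card_blocks_notMem_add (B := supportBlocksFinset D 4) i j
  have h2 : (((supportBlocksFinset D 4).filter fun b => i ∉ b ∧ j ∉ b).card : ℚ) +
      ((supportBlocksFinset D 4).filter fun b => i ∈ b).card +
      ((supportBlocksFinset D 4).filter fun b => j ∈ b).card = (supportBlocksFinset D 4).card +
      ((supportBlocksFinset D 4).filter fun b => i ∈ b ∧ j ∈ b).card := by exact_mod_cast h1
  rw [h.cast_card_blocks_mem hq hD hK, h.cast_card_blocks_mem hq hD hK,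
    h.cast_card_blocks hq hD hK, h.cast_card_blocks_pair hq hD hK hij] at h2
  linear_combination h2

/-- Integrality of the rational `r` needs no arithmetic: it is the block count of the pair formed by
the first and last coordinates. -/
theorem isDesign_two_of_cast_ncard {B : Set (Finset (Fin (q + 1)))} {k : ℕ} {r : ℚ} (hr : 0 < r)
    (hq : 0 < q) (hk : 2 < k) (hkq : k < q + 1) (hB : ∀ b ∈ B, b.card = k)
    (hlam : ∀ i j : Fin (q + 1), i ≠ j → ({b ∈ B | {i, j} ⊆ b}.ncard : ℚ) = r) :
    ∃ lam : ℕ, (lam : ℚ) = r ∧ IsDesign B 2 (q + 1) k lam := by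
  have h01 : (0 : Fin (q + 1)) ≠ Fin.last q := by
    rw [Ne, Fin.ext_iff, Fin.val_zero, Fin.val_last]
    omega
  refine ⟨_, hlam _ _ h01, by simp, by omega, hk, hkq, ?_, hB, ?_⟩
  · rw [Nat.one_le_iff_ne_zero, ← Nat.cast_ne_zero (R := ℚ), hlam _ _ h01]
    exact hr.ne'
  · intro T hT
    obtain ⟨i, j, hij, rfl⟩ := Finset.card_eq_two.1 hT
    exact Nat.cast_injective (R := ℚ) ((hlam _ _ hij).trans (hlam _ _ h01).symm)

theorem IsUnitCircle.isDesign_supportBlocks (h : IsUnitCircle σ v) (hq : 4 < q)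
    (hD : HasQuadraticChecks D v) (hK : Module.finrank F K = 2) :
    ∃ lam : ℕ, (lam : ℚ) = ((q : ℚ) - 4) / 2 ∧
      IsDesign (supportBlocks D 4) 2 (q + 1) 4 lam := by
  have hq' : (4 : ℚ) < q := by exact_mod_cast hq
  refine isDesign_two_of_cast_ncard (by linarith) (by omega) (by omega) (by omega)
    (fun b hb => card_of_mem_supportBlocks hb) fun i j hij => ?_
  rw [ncard_supportBlocks_sep, ← h.cast_card_blocks_pair hq hD hK hij]
  simp [Finset.insert_subset_iff]

theorem IsUnitCircle.isDesign_supportBlocks_dualCode (h : IsUnitCircle σ v) (hq : 5 < q)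
    (hD : HasQuadraticChecks D v) (hK : Module.finrank F K = 2) :
    ∃ lam : ℕ, (lam : ℚ) = ((q : ℚ) - 4) ^ 2 * (q - 3) / 24 ∧
      IsDesign (supportBlocks (dualCode D) (q - 3)) 2 (q + 1) (q - 3) lam := by
  have hq' : (5 : ℚ) < q := by exact_mod_cast hq
  have hpos : 0 < ((q : ℚ) - 4) ^ 2 * (q - 3) / 24 :=
    div_pos (mul_pos (pow_pos (by linarith) 2) (by linarith)) (by norm_num)
  refine isDesign_two_of_cast_ncard hpos (by omega) (by omega) (by omega)
    (fun b hb => card_of_mem_supportBlocks hb) fun i j hij => ?_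
  have hdual := supportBlocks_dualCode (by omega) (h.finrank_add_four (by omega) hD hK)
    (h.eq_zero_of_hammingNorm_le (by omega) hD) (h.block_ext hD)
  rw [show q + 1 - 4 = q - 3 by omega] at hdual
  have heq : {b ∈ supportBlocks (dualCode D) (q - 3) | {i, j} ⊆ b} =
      (fun b => bᶜ) '' {b ∈ supportBlocks D 4 | i ∉ b ∧ j ∉ b} := by
    rw [hdual]
    ext b
    constructor
    · rintro ⟨⟨c, hc, rfl⟩, hb⟩
      exact ⟨c, ⟨hc, by simpa [Finset.insert_subset_iff] using hb⟩, rfl⟩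
    · rintro ⟨c, ⟨hc, hb⟩, rfl⟩
      exact ⟨⟨c, hc, rfl⟩, by simpa [Finset.insert_subset_iff] using hb⟩
  rw [heq, Set.ncard_image_of_injective _ compl_injective, ncard_supportBlocks_sep,
    h.cast_card_blocks_notMem (by omega) hD hK hij]

end UnitCircleDesign

/-! ### From the generator polynomial to parity checks. -/

section CyclicCode

variable {F : Type*} [Field F]

/-- Since `g` divides the modulus, divisibility modulo xⁿ - 1 lifts to polynomials. -/
theorem mem_cyclicCode {n : ℕ} {g : F[X]} (hg : g ∣ X ^ n - 1) {c : Fin n → F} :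
    c ∈ cyclicCode n g ↔ g ∣ ∑ i : Fin n, C (c i) * X ^ (i : ℕ) := by
  change AdjoinRoot.mk (X ^ n - 1 : F[X]) (∑ i : Fin n, C (c i) * X ^ (i : ℕ)) ∈
    Ideal.span {AdjoinRoot.mk (X ^ n - 1 : F[X]) g} ↔ _
  rw [Ideal.mem_span_singleton]
  constructor
  · rintro ⟨r, hr⟩
    obtain ⟨r, rfl⟩ := AdjoinRoot.mk_surjective r
    rw [← map_mul, AdjoinRoot.mk_eq_mk] at hr
    have := dvd_add (hg.trans hr) (dvd_mul_right g r)
    rwa [sub_add_cancel] at this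
  · exact map_dvd _

theorem bchGenerator_dvd_iff {K : Type*} [Field K] [Algebra F K] {n δ : ℕ} {h : ℤ} {α : Kˣ}
    {p : F[X]} : bchGenerator F n δ h α ∣ p ↔
      ∀ i < δ - 1, aeval ((bchRoot F n α ^ (h + (i : ℤ)) : Kˣ) : K) p = 0 := by
  classical
  simp only [bchGenerator, Finset.lcm_dvd_iff, Finset.mem_range, minpoly.dvd_iff]

theorem mem_bchCode {K : Type*} [Field K] [Algebra F K] {n δ : ℕ} {h : ℤ} {α : Kˣ}
    (hn : bchRoot F n α ^ n = 1) {c : Fin n → F} :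
    c ∈ bchCode F n δ h α ↔ ∀ i < δ - 1, ∑ j : Fin n, algebraMap F K (c j) *
      ((bchRoot F n α ^ (h + (i : ℤ)) : Kˣ) : K) ^ (j : ℕ) = 0 := by
  rw [bchCode, mem_cyclicCode, bchGenerator_dvd_iff]
  · simp
  · rw [bchGenerator_dvd_iff]
    intro i _
    have : (bchRoot F n α ^ (h + (i : ℤ))) ^ n = 1 := by
      rw [← zpow_natCast, ← zpow_mul, mul_comm, zpow_mul, zpow_natCast, hn, one_zpow]
    rw [map_sub, map_pow, aeval_X, map_one, ← Units.val_pow_eq_pow_val, this, Units.val_one,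
      sub_self]

theorem hasQuadraticChecks_bchCode {K : Type*} [Field K] [Algebra F K] {n : ℕ} {α : Kˣ}
    (hn : bchRoot F n α ^ n = 1) :
    HasQuadraticChecks (bchCode F n 3 1 α)
      (fun i : Fin n => ((bchRoot F n α : Kˣ) : K) ^ (i : ℕ)) := by
  intro c
  rw [mem_bchCode hn]
  have h2 : (bchRoot F n α ^ (1 + ((1 : ℕ) : ℤ)) : Kˣ) = bchRoot F n α ^ 2 := by
    rw [← zpow_natCast]
    rfl
  constructor
  · intro h
    refine ⟨by simpa using h 0 (by omega), ?_⟩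
    have := h 1 (by omega)
    rw [h2] at this
    simpa [← pow_mul, mul_comm] using this
  · rintro ⟨h0, h1⟩ i hi
    obtain rfl | rfl : i = 0 ∨ i = 1 := by omega
    · simpa using h0
    · rw [h2]
      simpa [← pow_mul, mul_comm] using h1

end CyclicCode

/-! ### The (q+1)-st roots of unity form a unit circle. -/

section FiniteFields

theorem orderOf_cast_succ {q : ℕ} (hq : 1 < q) : orderOf (q : ZMod (q + 1)) = 2 := by
  have hq1 : (q : ZMod (q + 1)) = -1 := by
    rw [eq_neg_iff_add_eq_zero]
    exact_mod_cast ZMod.natCast_self (q + 1)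
  have : Fact (2 < q + 1) := ⟨by omega⟩
  refine orderOf_eq_prime (by rw [hq1]; ring) ?_
  rw [hq1]
  exact ZMod.neg_one_ne_one

/-- The image of F already exhausts the at most |F| roots of X^|F| - X. -/
theorem mem_range_algebraMap_of_pow_card {F K : Type*} [Field F] [Fintype F] [Field K]
    [Algebra F K] {x : K} (hx : x ^ Fintype.card F = x) : ∃ a : F, algebraMap F K a = x := by
  classical
  let S : Finset K := Finset.univ.image (algebraMap F K)
  have hp : (X ^ Fintype.card F - X : K[X]) ≠ 0 :=
    FiniteField.X_pow_card_sub_X_ne_zero K Fintype.one_lt_card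
  have hsub : S ⊆ (X ^ Fintype.card F - X : K[X]).roots.toFinset := by
    intro y hy
    obtain ⟨a, -, rfl⟩ := Finset.mem_image.1 hy
    rw [Multiset.mem_toFinset, mem_roots hp, IsRoot, eval_sub, eval_pow, eval_X, ← map_pow,
      FiniteField.pow_card, sub_self]
  have heq := Finset.eq_of_subset_of_card_le hsub (by
    rw [Finset.card_image_of_injective _ (algebraMap F K).injective, Finset.card_univ]
    refine (Multiset.toFinset_card_le _).trans ((card_roots' _).trans ?_)
    rw [FiniteField.X_pow_card_sub_X_natDegree_eq K Fintype.one_lt_card])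
  have hxS : x ∈ S := by
    rw [heq, Multiset.mem_toFinset, mem_roots hp, IsRoot, eval_sub, eval_pow, eval_X, hx, sub_self]
  obtain ⟨a, -, ha⟩ := Finset.mem_image.1 hxS
  exact ⟨a, ha⟩

theorem isUnitCircle_pow {F K : Type*} [Field F] [Fintype F] [Field K] [Algebra F K] {q : ℕ}
    (hF : Fintype.card F = q) (h2 : (2 : K) = 0) (hq2 : Even q) (hq3 : q % 3 = 1) {β : K}
    (hβ : IsPrimitiveRoot β (q + 1)) :
    IsUnitCircle (FiniteField.frobeniusAlgHom F K) (fun i : Fin (q + 1) => β ^ (i : ℕ)) := by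
  have hβ0 : β ≠ 0 := hβ.ne_zero (by omega)
  have hpow : ∀ i : ℕ, (β ^ i) ^ (q + 1) = 1 := fun i => by
    rw [← pow_mul, mul_comm, pow_mul, hβ.pow_eq_one, one_pow]
  have hsurj : ∀ x : K, x ^ (q + 1) = 1 → ∃ i : Fin (q + 1), β ^ (i : ℕ) = x := by
    intro x hx
    obtain ⟨i, hi, rfl⟩ := hβ.eq_pow_of_pow_eq_one hx
    exact ⟨⟨i, hi⟩, rfl⟩
  have hinj : Function.Injective fun i : Fin (q + 1) => β ^ (i : ℕ) :=
    fun i j hij => Fin.ext (hβ.pow_inj i.2 j.2 hij)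
  refine ⟨h2, fun x hx => ?_, hinj, fun i => pow_ne_zero _ hβ0, fun i => ?_, fun x hx0 hx => ?_,
    fun i j hij => ?_, fun i j => ?_⟩
  · exact mem_range_algebraMap_of_pow_card hx
  · rw [FiniteField.coe_frobeniusAlgHom, hF]
    exact eq_inv_of_mul_eq_one_left (by rw [← pow_succ, hpow])
  · rw [FiniteField.coe_frobeniusAlgHom, hF] at hx
    dsimp only at hx
    exact hsurj x (by rw [pow_succ, hx, inv_mul_cancel₀ hx0])
  · apply hinj
    have hi := hpow i
    have hj := hpow j
    dsimp only at hij ⊢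
    generalize β ^ (i : ℕ) = x at *
    generalize β ^ (j : ℕ) = y at *
    -- As q + 1 = 3m + 2, equal cubes give equal squares, hence equal elements.
    obtain ⟨m, hm⟩ : ∃ m, q + 1 = 3 * m + 2 := ⟨q / 3, by omega⟩
    rw [hm, pow_add, pow_mul] at hi hj
    rw [hij] at hi
    have hm0 : (y ^ 3) ^ m ≠ 0 := left_ne_zero_of_mul_eq_one hi
    have hsq : x ^ 2 = y ^ 2 := mul_left_cancel₀ hm0 (hi.trans hj.symm)
    have : y ^ 2 ≠ 0 := right_ne_zero_of_mul_eq_one hj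
    apply mul_left_cancel₀ this
    linear_combination hij - x * hsq
  · obtain ⟨m, hm⟩ := hq2
    -- With q = 2m, the exponent m + 1 inverts 2 modulo q + 1.
    obtain ⟨k, hk⟩ := hsurj ((β ^ (i : ℕ) * β ^ (j : ℕ)) ^ (m + 1)) (by
      rw [pow_right_comm, mul_pow, hpow, hpow, one_mul, one_pow])
    refine ⟨k, ?_⟩
    rw [hk, ← pow_mul, show (m + 1) * 2 = q + 1 + 1 by omega, pow_succ, mul_pow, hpow, hpow,
      one_mul, one_mul]

end FiniteFields

/-! ### The BCH root is a primitive (q+1)-st root of unity. -/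

section BCHRoot

theorem bchRoot_isPrimitiveRoot {F K : Type*} [Field F] [Finite F] [Field K] [Algebra F K] {q : ℕ}
    (hF : Nat.card F = q) (hK : Module.finrank F K = 2) {α : Kˣ}
    (hα : ∀ x : Kˣ, x ∈ Subgroup.zpowers α) :
    IsPrimitiveRoot ((bchRoot F (q + 1) α : Kˣ) : K) (q + 1) := by
  have hq : 1 < q := hF ▸ Finite.one_lt_card
  have : Module.Finite F K := Module.finite_of_finrank_eq_succ hK
  have : Finite K := Module.finite_of_finite F
  have hcard : Nat.card K = q ^ 2 := by rw [Module.natCard_eq_pow_finrank (K := F), hF, hK]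
  have hsq : q ^ 2 - 1 = (q - 1) * (q + 1) := by
    rw [mul_comm, ← Nat.sq_sub_sq q 1]
  have hord : orderOf α = (q - 1) * (q + 1) := by
    rw [orderOf_eq_card_of_forall_mem_zpowers hα, Nat.card_units, hcard, hsq]
  have hroot : bchRoot F (q + 1) α = α ^ (q - 1) := by
    rw [bchRoot, hF, orderOf_cast_succ hq, hsq, Nat.mul_div_cancel _ (by omega)]
  rw [IsPrimitiveRoot.coe_units_iff, hroot]
  exact (IsPrimitiveRoot.orderOf α).pow (orderOf_pos α) hord

end BCHRoot

/-! ### Assembly. -/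

theorem mainTheorem2 (s q : ℕ) (hs : 4 ≤ s) (hs_even : Even s) (hq : q = 2 ^ s)
    {F : Type*} [Field F] [DecidableEq F] (hF : Nat.card F = q)
    {K : Type*} [Field K] [Algebra F K]
    (hK : Module.finrank F K = orderOf (q : ZMod (q + 1)))
    (α : Kˣ) (hα : ∀ x : Kˣ, x ∈ Subgroup.zpowers α) :
    HasParameters (bchCode F (q + 1) 3 1 α) (q - 3) 4 ∧
    HasParameters (dualCode (bchCode F (q + 1) 3 1 α)) 4 (q - 3) ∧
    IsNMDS (bchCode F (q + 1) 3 1 α) ∧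
    weightEnumerator (dualCode (bchCode F (q + 1) 3 1 α)) =
      1 + C (((q : ℚ) - 4) * (q - 1) * q * (q + 1) / 24) * X ^ (q - 3)
        + C (((q : ℚ) - 1) * q * (q + 1) / 2) * X ^ (q - 2)
        + C (((q : ℚ) + 1) * q ^ 2 * (q - 1) / 4) * X ^ (q - 1)
        + C (((q : ℚ) - 1) * (q + 1) * (2 * q ^ 2 + q + 6) / 6) * X ^ q
        + C ((3 * (q : ℚ) ^ 4 - 4 * q ^ 3 - 3 * q ^ 2 + 4 * q) / 8) * X ^ (q + 1) ∧
    (∃ lam : ℕ, (lam : ℚ) = ((q : ℚ) - 4) / 2 ∧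
      IsDesign (supportBlocks (bchCode F (q + 1) 3 1 α) 4) 2 (q + 1) 4 lam) ∧
    (∃ lam : ℕ, (lam : ℚ) = ((q : ℚ) - 4) ^ 2 * (q - 3) / 24 ∧
      IsDesign (supportBlocks (dualCode (bchCode F (q + 1) 3 1 α)) (q - 3))
        2 (q + 1) (q - 3) lam) ∧
    supportBlocks (dualCode (bchCode F (q + 1) 3 1 α)) (q - 3) =
      (fun b => bᶜ) '' supportBlocks (bchCode F (q + 1) 3 1 α) 4 := by
  have hq16 : 16 ≤ q := by
    rw [hq]
    exact Nat.pow_le_pow_right (n := 2) (by omega) hs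
  have hfin : Finite F := Nat.finite_of_card_ne_zero (by omega)
  have := Fintype.ofFinite F
  have hF' : Fintype.card F = q := by rw [← Nat.card_eq_fintype_card, hF]
  rw [orderOf_cast_succ (by omega)] at hK
  have h2 : (2 : K) = 0 := by
    have h := FiniteField.cast_card_eq_zero F
    rw [hF', hq, Nat.cast_pow] at h
    have h' : (2 : F) = 0 := by exact_mod_cast pow_eq_zero_iff (by omega) |>.1 h
    rw [← map_ofNat (algebraMap F K) 2, h', map_zero]
  have hq2 : Even q := hq ▸ (even_two.pow_of_ne_zero (by omega))
  -- The evenness of s enters here: q is a power of 4.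
  have hq3 : q % 3 = 1 := by
    obtain ⟨t, rfl⟩ := hs_even
    rw [hq, ← two_mul, pow_mul, Nat.pow_mod]
    simp
  have hβ := bchRoot_isPrimitiveRoot hF hK hα
  have h := isUnitCircle_pow hF' h2 hq2 hq3 hβ
  have hC := hasQuadraticChecks_bchCode (F := F) (n := q + 1) (α := α)
    (IsPrimitiveRoot.coe_units_iff.1 hβ).pow_eq_one
  generalize bchCode F (q + 1) 3 1 α = C at hC ⊢
  have hdim := h.finrank_add_four (by omega) hC hK
  have hmin := h.eq_zero_of_hammingNorm_le (by omega) hC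
  have hB := h.block_ext hC
  have hne := h.supportBlocks_nonempty (by omega) hC hK
  have hsub : q + 1 - 4 = q - 3 := by omega
  have hpC := hasParameters_of_supportBlocks_nonempty hdim hmin hne
  have hpD := hasParameters_dualCode (by omega) hdim hmin hB hne
  have hdual := supportBlocks_dualCode (by omega) hdim hmin hB
  rw [hsub] at hpC hpD hdual
  refine ⟨hpC, hpD, ⟨⟨_, _, hpC, by omega⟩, ⟨_, _, hpD, by omega⟩⟩, ?_,
    h.isDesign_supportBlocks (by omega) hC hK,
    h.isDesign_supportBlocks_dualCode (by omega) hC hK, hdual⟩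
  exact weightEnumerator_dualCode (by omega) hF' hdim hmin hB
    (by rw [ncard_supportBlocks, h.cast_card_blocks (by omega) hC hK])
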